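/- Let $K/F$ be a cyclic Galois field extension of degree $n$ with Galois group generated by $\sigma$, and let $R=K[t;\sigma]$ be the twisted polynomial ring, with $ta=\sigma(a)t$ for $a\in K$. For nonzero $f\in R$ of degree $m$, the Petit algebra $R/Rf$ is the set of all $g\in R$ with $\deg g<m$, with termwise addition and the product of $g$ and $h$ given by the remainder of $gh$ upon right division by $f$ (that is, $gh=qf+r$ with $\deg r<m$). The minimal central left multiple of $f$ is the polynomial $\hat h(t^n)$, with $\hat h\in F[x]$ monic of least degree such that $\hat h(t^n)\in Rf$. A nonassociative ring $A\neq 0$ is a division ring if left and right multiplication by every nonzero element are bijective. Two such rings $A,A'$ are isotopic if there are additive bijections $\varphi,\psi,\chi:A\to A'$, linear over some common subfield, with $\chi(xy)=\varphi(x)\psi(y)$ for all $x,y\in A$; they are isotopic over a field $F_0$ if these maps can be chosen $F_0$-linear. Let ${\rm Aut}(K)_\sigma=\{\tau\in{\rm Aut}(K):\tau\sigma=\sigma\tau\}$; its elements restrict to automorphisms of $F$. Let $G=N_{K/F}(K^\times)\rtimes{\rm Aut}(K)_\sigma$ act on the set $I(F,m_0)$ of monic irreducible polynomials of degree $m_0$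 in $F[x]$ by $p^{(\lambda,\tau)}(x)=\lambda^{-m_0}p^\tau(\lambda x)$, where $p^\tau$ is obtained by applying $\tau$ to the coefficients. For $f=\sum_{i=0}^m a_it^i\in R$ of degree $m$, $\alpha\in K^\times$ and $\tau\in{\rm Aut}(K)_\sigma$ put $$f^{(\alpha,\tau)}(t)=N_m^\sigma(\alpha^{-1})\sum_{i=0}^m\tau(a_i)N_i^\sigma(\alpha)t^i,\qquad N_i^\sigma(\alpha)=\prod_{j=0}^{i-1}\sigma^j(\alpha).$$ Theorem. Let $f,g\in R$ be irreducible of degree $m$ with minimal central left multiples $\hat h_1(t^n)$ and $\hat h_2(t^n)$, and suppose that $\hat h_1$ and $\hat h_2$ lie in the same $G$-orbit of $I(F,m_0)$. Then $R/Rf$ and $R/Rg$ are isotopic division rings. Moreover, let $(\lambda,\tau)\in G$ be any element with $\hat h_2=\hat h_1^{(\lambda,\tau)}$, and let $F_0=\{c\in F:\tau(c)=c\}$. Then $R/Rf$ and $R/Rg$ are isotopic over $F_0$, and for all $\tau_i\in{\rm Aut}(K)_\sigma$ with $\tau_i|_F=\tau|_F$ and all $\alpha\in K^\times$ with $N_{K/F}(\alpha)=\lambda$,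 the polynomial $f^{(\alpha,\tau_i)}$ is irreducible of degree $m$ with minimal central left multiple $\hat h_1^{(\lambda,\tau)}(t^n)$, and $R/Rf^{(\alpha,\tau_i)}$ is a division ring that is isotopic over $F_0$ to both $R/Rf$ and $R/Rg$. -/

import Mathlib

/-! ### The twisted polynomial ring `K[t; σ]` -/

section Twisted

variable {F K : Type*} [Field F] [Field K] [Algebra F K]

/-- The action of the monoid `ℕ` on `K` in which `1` acts as `σ`. -/
abbrev twistAction (σ : K ≃ₐ[F] K) : MulSemiringAction (Multiplicative ℕ) K :=
  MulSemiringAction.compHom K (powersHom (K ≃ₐ[F] K) σ)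

/-- The twisted polynomial ring `R = K[t; σ]`: left polynomials `∑ aᵢ tⁱ` with `t a = σ(a) t`.
This is Mathlib's ring of skew polynomials for the action of `ℕ` on `K` through `σ`. -/
def TwistedPoly (_σ : K ≃ₐ[F] K) : Type _ := SkewPolynomial K

namespace TwistedPoly

variable {σ : K ≃ₐ[F] K}

noncomputable instance : Ring (TwistedPoly σ) :=
  letI := twistAction σ
  inferInstanceAs (Ring (SkewPolynomial K))

noncomputable instance : Module K (TwistedPoly σ) :=
  inferInstanceAs (Module K (SkewMonoidAlgebra K (Multiplicative ℕ)))

/-- The coefficient of `tⁱ`. -/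
def coeff (f : TwistedPoly σ) (i : ℕ) : K := SkewPolynomial.coeff f i

/-- The finite set of exponents with nonzero coefficient. -/
def support (f : TwistedPoly σ) : Finset ℕ := SkewPolynomial.support f

/-- The monomial `a tⁱ`. -/
noncomputable def monomial (σ : K ≃ₐ[F] K) (i : ℕ) (a : K) : TwistedPoly σ :=
  (SkewPolynomial.monomial i a : SkewPolynomial K)

/-- The degree (with value `0` at the zero polynomial). -/
def natDegree (f : TwistedPoly σ) : ℕ := f.support.sup id

lemma mem_support {f : TwistedPoly σ} {i : ℕ} : i ∈ f.support ↔ f.coeff i ≠ 0 :=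
  SkewPolynomial.mem_support_iff

lemma ext {f g : TwistedPoly σ} (h : ∀ i, f.coeff i = g.coeff i) : f = g :=
  SkewPolynomial.ext_iff.2 h

lemma coeff_zero (i : ℕ) : (0 : TwistedPoly σ).coeff i = 0 := rfl

lemma coeff_add (f g : TwistedPoly σ) (i : ℕ) : (f + g).coeff i = f.coeff i + g.coeff i :=
  SkewPolynomial.coeff_add f g i

lemma coeff_sub (f g : TwistedPoly σ) (i : ℕ) : (f - g).coeff i = f.coeff i - g.coeff i :=
  SkewPolynomial.coeff_sub f g i

lemma coeff_smul (a : K) (f : TwistedPoly σ) (i : ℕ) : (a • f).coeff i = a * f.coeff i := rfl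

lemma coeff_monomial (i j : ℕ) (a : K) :
    (monomial σ i a).coeff j = if i = j then a else 0 :=
  SkewPolynomial.coeff_monomial

lemma coeff_mul (f g : TwistedPoly σ) (k : ℕ) :
    (f * g).coeff k = ∑ p ∈ Finset.HasAntidiagonal.antidiagonal k, f.coeff p.1 * (σ ^ p.1) (g.coeff p.2) := by
  let _ := twistAction σ
  have h := SkewMonoidAlgebra.coeff_mul_antidiagonal_of_finset (k := K) (G := Multiplicative ℕ)
    f g (Multiplicative.ofAdd k)
    ((Finset.HasAntidiagonal.antidiagonal k).map
      ((Multiplicative.ofAdd.prodCongr Multiplicative.ofAdd).toEmbedding))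
    (by
      rintro ⟨a, b⟩
      simp only [Finset.mem_map, Finset.HasAntidiagonal.mem_antidiagonal]
      constructor
      · rintro ⟨⟨x, y⟩, hxy, h⟩
        cases h
        exact congrArg Multiplicative.ofAdd hxy
      · intro h
        exact ⟨(a.toAdd, b.toAdd), congrArg Multiplicative.toAdd h, rfl⟩)
  rw [Finset.sum_map] at h
  exact h

lemma coeff_eq_zero_of_natDegree_lt {f : TwistedPoly σ} {i : ℕ} (h : f.natDegree < i) :
    f.coeff i = 0 := by
  by_contra hc
  exact absurd (Finset.le_sup (f := id) (mem_support.2 hc)) (not_le.2 h)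

lemma coeff_natDegree_ne_zero {f : TwistedPoly σ} (hf : f ≠ 0) : f.coeff f.natDegree ≠ 0 := by
  have hne : f.support.Nonempty := by
    rw [Finset.nonempty_iff_ne_empty]
    intro h
    apply hf
    apply ext
    intro i
    by_contra hc
    have := mem_support.2 hc
    simp [h] at this
  obtain ⟨i, hi, h⟩ := Finset.exists_mem_eq_sup f.support hne id
  rw [natDegree, h]
  exact mem_support.1 hi

/-- The left `K`-space of twisted polynomials of degree less than `m`. -/
def degreeLT (σ : K ≃ₐ[F] K) (m : ℕ) : Submodule K (TwistedPoly σ) where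
  carrier := {g | ∀ i, m ≤ i → g.coeff i = 0}
  add_mem' := fun ha hb i hi => by rw [coeff_add, ha i hi, hb i hi, add_zero]
  zero_mem' := fun _ _ => rfl
  smul_mem' := fun c g hg i hi => by rw [coeff_smul, hg i hi, mul_zero]

/-- Right division: every `g` is `q f + r` with `deg r < deg f`. -/
theorem exists_right_division {f : TwistedPoly σ} (hf : f ≠ 0) (g : TwistedPoly σ) :
    ∃ r ∈ degreeLT σ f.natDegree, ∃ q, g = q * f + r := by
  suffices H : ∀ N (g : TwistedPoly σ), (∀ i, N ≤ i → g.coeff i = 0) →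
      ∃ r ∈ degreeLT σ f.natDegree, ∃ q, g = q * f + r from
    H (g.natDegree + 1) g fun i hi => coeff_eq_zero_of_natDegree_lt (by omega)
  intro N
  induction N with
  | zero => exact fun g hg => ⟨g, fun i _ => hg i (Nat.zero_le i), 0, by simp⟩
  | succ N ih =>
    intro g hg
    by_cases hN : N < f.natDegree
    · exact ⟨g, fun i hi => hg i (by omega), 0, by simp⟩
    · push Not at hN
      obtain ⟨k, rfl⟩ := Nat.exists_eq_add_of_le' hN
      set m := f.natDegree with hm
      have hlc : (σ ^ k) (f.coeff m) ≠ 0 :=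
        (map_ne_zero _).2 (coeff_natDegree_ne_zero hf)
      set c := g.coeff (k + m) / (σ ^ k) (f.coeff m) with hc
      obtain ⟨r, hr, q, hq⟩ := ih (g - monomial σ k c * f) (by
        intro i hi
        rw [coeff_sub, coeff_mul, Finset.sum_eq_single (k, i - k)]
        · rw [coeff_monomial, if_pos rfl]
          rcases hi.eq_or_lt with rfl | hi'
          · simp only [Nat.add_sub_cancel_left]
            rw [hc, div_mul_cancel₀ _ hlc, sub_self]
          · rw [hg i (by omega), coeff_eq_zero_of_natDegree_lt (f := f) (i := i - k) (by omega)]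
            simp
        · rintro ⟨a, b⟩ hab hne
          rw [Finset.HasAntidiagonal.mem_antidiagonal] at hab
          rw [coeff_monomial, if_neg, zero_mul]
          rintro rfl
          exact hne (by ext <;> simp at hab ⊢; omega)
        · intro h
          exact absurd (Finset.HasAntidiagonal.mem_antidiagonal.2 (by simp; omega)) h)
      exact ⟨r, hr, q + monomial σ k c, by rw [add_mul, add_right_comm, ← hq]; abel⟩

lemma mul_mem_degreeLT {f q : TwistedPoly σ} (hf : f ≠ 0)
    (h : q * f ∈ degreeLT σ f.natDegree) : q = 0 := by
  by_contra hq
  have h1 := h (q.natDegree + f.natDegree) (by omega)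
  rw [coeff_mul, Finset.sum_eq_single (q.natDegree, f.natDegree)] at h1
  · exact mul_ne_zero (coeff_natDegree_ne_zero hq)
      ((map_ne_zero _).2 (coeff_natDegree_ne_zero hf)) h1
  · rintro ⟨a, b⟩ hab hne
    rw [Finset.HasAntidiagonal.mem_antidiagonal] at hab
    simp only at hab ⊢
    by_cases ha : q.natDegree < a
    · rw [coeff_eq_zero_of_natDegree_lt ha, zero_mul]
    · have hb : f.natDegree < b := by
        rcases eq_or_ne a q.natDegree with rfl | hne'
        · exact absurd (by ext <;> simp; omega) hne
        · omega
      rw [coeff_eq_zero_of_natDegree_lt hb, map_zero, mul_zero]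
  · simp

/-- Right division: the remainder is unique. -/
theorem right_remainder_unique {f : TwistedPoly σ} {r r' q q' : TwistedPoly σ}
    (hf : f ≠ 0) (hr : r ∈ degreeLT σ f.natDegree) (hr' : r' ∈ degreeLT σ f.natDegree)
    (h : q * f + r = q' * f + r') : r = r' := by
  have h1 : (q - q') * f = r' - r := by
    rw [sub_mul, sub_eq_sub_iff_add_eq_add, h, add_comm]
  have h2 := mul_mem_degreeLT hf (h1 ▸ Submodule.sub_mem _ hr' hr)
  rw [h2, zero_mul] at h1
  exact (sub_eq_zero.1 h1.symm).symm

open Classical in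
/-- `g mod_r f`: the remainder of `g` upon right division by `f`
(with the value `0` if `f = 0`). -/
noncomputable def modRight (g f : TwistedPoly σ) : degreeLT σ f.natDegree :=
  if hf : f = 0 then 0
  else ⟨(exists_right_division hf g).choose, (exists_right_division hf g).choose_spec.1⟩

lemma modRight_spec (g : TwistedPoly σ) {f : TwistedPoly σ} (hf : f ≠ 0) :
    ∃ q, g = q * f + (modRight g f : TwistedPoly σ) := by
  rw [modRight, dif_neg hf]
  exact (exists_right_division hf g).choose_spec.2

lemma modRight_eq {f g q : TwistedPoly σ} (hf : f ≠ 0) {r : degreeLT σ f.natDegree}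
    (h : g = q * f + r) : modRight g f = r := by
  obtain ⟨q', h'⟩ := modRight_spec g hf
  exact Subtype.ext (right_remainder_unique hf (modRight g f).2 r.2 (h'.symm.trans h))

lemma modRight_add (a b f : TwistedPoly σ) :
    modRight (a + b) f = modRight a f + modRight b f := by
  by_cases hf : f = 0
  · simp [modRight, hf]
  · obtain ⟨p, hp⟩ := modRight_spec a hf
    obtain ⟨q, hq⟩ := modRight_spec b hf
    refine modRight_eq hf (q := p + q) ?_
    conv_lhs => rw [hp, hq]
    rw [add_mul, Submodule.coe_add]
    abel

lemma modRight_zero (f : TwistedPoly σ) : modRight 0 f = 0 := by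
  have h := modRight_add 0 0 f
  rw [add_zero] at h
  exact left_eq_add.1 h

/-- The central polynomial `p(tⁿ)`, for `p ∈ F[x]` and `n = [K : F]`. -/
noncomputable def central (σ : K ≃ₐ[F] K) (p : Polynomial F) : TwistedPoly σ :=
  p.sum fun i c => monomial σ (Module.finrank F K * i) (algebraMap F K c)

/-- `h(tⁿ)` is the minimal central left multiple of `f`: `h ∈ F[x]` is monic, `h(tⁿ) = g f` for
some `g ∈ K[t; σ]`, and `h` has minimal degree among all such monic polynomials. -/
def IsMclm (f : TwistedPoly σ) (h : Polynomial F) : Prop :=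
  (h.Monic ∧ ∃ g, central σ h = g * f) ∧
    ∀ h' : Polynomial F, h'.Monic → (∃ g, central σ h' = g * f) → h.natDegree ≤ h'.natDegree

/-- `N_i^σ(α) = α σ(α) ⋯ σ^{i-1}(α)`. -/
def twistedNorm (σ : K ≃ₐ[F] K) (i : ℕ) (α : K) : K := ∏ j ∈ Finset.range i, (σ ^ j) α

/-- `f^{(α,τ)}(t) = N_m^σ(α⁻¹) ∑ τ(aᵢ) N_i^σ(α) tⁱ`, for `f = ∑ aᵢ tⁱ` of degree `m`. -/
noncomputable def twist (f : TwistedPoly σ) (α : Kˣ) (τ : K ≃+* K) : TwistedPoly σ :=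
  twistedNorm σ f.natDegree ((α⁻¹ : Kˣ) : K) •
    ∑ i ∈ f.support, monomial σ i (τ (f.coeff i) * twistedNorm σ i (α : K))

end TwistedPoly

/-! ### Petit algebras -/

/-- The Petit algebra `R/Rf`: the twisted polynomials of degree less than `deg f`, with the
multiplication `g ∘ h = gh mod_r f`. -/
def Petit {σ : K ≃ₐ[F] K} (f : TwistedPoly σ) : Type _ := TwistedPoly.degreeLT σ f.natDegree

namespace Petit

variable {σ : K ≃ₐ[F] K} {f : TwistedPoly σ}

noncomputable instance : AddCommGroup (Petit f) :=
  inferInstanceAs (AddCommGroup (TwistedPoly.degreeLT σ f.natDegree))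

noncomputable instance : Module K (Petit f) :=
  inferInstanceAs (Module K (TwistedPoly.degreeLT σ f.natDegree))

/-- Scalar multiplication by `F ⊆ K`. -/
noncomputable instance : Module F (Petit f) := Module.compHom (Petit f) (algebraMap F K)

/-- The polynomial of degree less than `deg f` underlying an element of `R/Rf`. -/
def toPoly (x : Petit f) : TwistedPoly σ := Subtype.val x

lemma toPoly_add (x y : Petit f) : (x + y).toPoly = x.toPoly + y.toPoly := rfl

lemma toPoly_zero : (0 : Petit f).toPoly = 0 := rfl

noncomputable instance : Mul (Petit f) := ⟨fun x y => TwistedPoly.modRight (x.toPoly * y.toPoly) f⟩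

lemma mul_def (x y : Petit f) : x * y = TwistedPoly.modRight (x.toPoly * y.toPoly) f := rfl

noncomputable instance : NonUnitalNonAssocRing (Petit f) where
  left_distrib x y z := by
    simp only [mul_def, toPoly_add, mul_add]
    exact TwistedPoly.modRight_add _ _ f
  right_distrib x y z := by
    simp only [mul_def, toPoly_add, add_mul]
    exact TwistedPoly.modRight_add _ _ f
  zero_mul x := by
    simp only [mul_def, toPoly_zero, zero_mul]
    exact TwistedPoly.modRight_zero f
  mul_zero x := by
    simp only [mul_def, toPoly_zero, mul_zero]
    exact TwistedPoly.modRight_zero f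

end Petit

end Twisted

/-! ### Division rings and isotopy -/

/-- A nonassociative ring `A ≠ 0` is a division ring if left and right multiplication by every
nonzero element are bijective. -/
def IsNonassocDivisionRing (A : Type*) [NonUnitalNonAssocRing A] : Prop :=
  Nontrivial A ∧ ∀ a : A, a ≠ 0 →
    Function.Bijective (fun x : A => a * x) ∧ Function.Bijective (fun x : A => x * a)

/-- `A` and `B` are isotopic over the field `E`: there are `E`-linear bijections `φ, ψ, χ` from
`A` to `B` with `χ(xy) = φ(x) ψ(y)`. -/
def IsotopicOver (E A B : Type*) [Field E] [NonUnitalNonAssocRing A] [NonUnitalNonAssocRing B]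
    [Module E A] [Module E B] : Prop :=
  ∃ φ ψ χ : A ≃ₗ[E] B, ∀ x y : A, χ (x * y) = φ x * ψ y

/-- The `F`-algebras `A` and `B` are isotopic as rings: there are additive bijections `φ, ψ, χ` from
`A` to `B`, linear over some subfield of `F`, with `χ(xy) = φ(x) ψ(y)`. -/
def IsotopicRings (F A B : Type*) [Field F] [NonUnitalNonAssocRing A] [NonUnitalNonAssocRing B]
    [Module F A] [Module F B] : Prop :=
  ∃ E : Subfield F, IsotopicOver E A B

/-! ### The group `G` and its action on monic irreducible polynomials -/

section Group

variable {F K : Type*} [Field F] [Field K] [Algebra F K]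

/-- `Aut(K)_σ`: the ring automorphisms of `K` that commute with `σ` and restrict to an automorphism
of `F`. If `F` is the fixed field of `σ`, then the second condition follows from the first,
see `mem_autStable_iff`. -/
def autStable (σ : K ≃ₐ[F] K) : Subgroup (RingAut K) where
  carrier := {τ | (∀ a, τ (σ a) = σ (τ a)) ∧
    ∃ ρ : RingAut F, ∀ c, τ (algebraMap F K c) = algebraMap F K (ρ c)}
  mul_mem' := by
    rintro τ τ' ⟨h, ρ, hρ⟩ ⟨h', ρ', hρ'⟩
    exact ⟨fun a => by rw [RingAut.mul_apply, RingAut.mul_apply, h', h],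
      ρ * ρ', fun c => by rw [RingAut.mul_apply, RingAut.mul_apply, hρ', hρ]⟩
  one_mem' := ⟨fun _ => rfl, 1, fun _ => rfl⟩
  inv_mem' := by
    rintro τ ⟨h, ρ, hρ⟩
    refine ⟨fun a => ?_, ρ⁻¹, fun c => ?_⟩
    · apply τ.injective
      rw [h]
      change τ (τ.symm _) = σ (τ (τ.symm a))
      simp
    · apply τ.injective
      rw [hρ]
      change τ (τ.symm _) = algebraMap F K (ρ (ρ.symm c))
      simp

/-- When `σ` generates the Galois group of `K/F`, the group `Aut(K)_σ` is the centralizer of `σ`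
in `Aut(K)`. -/
theorem mem_autStable_iff [FiniteDimensional F K] [IsGalois F K] {σ : K ≃ₐ[F] K}
    (hσ : ∀ ρ : K ≃ₐ[F] K, ρ ∈ Subgroup.zpowers σ) (τ : RingAut K) :
    τ ∈ autStable σ ↔ ∀ a, τ (σ a) = σ (τ a) := by
  refine ⟨fun h => h.1, fun h => ⟨h, ?_⟩⟩
  have hfix : ∀ a : K, σ a = a → a ∈ Set.range (algebraMap F K) := by
    intro a ha
    rw [IsGalois.mem_range_algebraMap_iff_fixed]
    intro ρ
    have : σ ∈ MulAction.stabilizer (K ≃ₐ[F] K) a := ha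
    exact (Subgroup.zpowers_le.2 this) (hσ ρ)
  have hsymm : ∀ a, τ.symm (σ a) = σ (τ.symm a) := fun a => by
    apply τ.injective
    rw [h]
    simp
  have h1 : ∀ c : F, ∃ d : F, algebraMap F K d = τ (algebraMap F K c) := fun c =>
    hfix _ (by rw [← h, σ.commutes])
  have h2 : ∀ c : F, ∃ d : F, algebraMap F K d = τ.symm (algebraMap F K c) := fun c =>
    hfix _ (by rw [← hsymm, σ.commutes])
  choose u hu using h1
  choose v hv using h2
  have inj := (algebraMap F K).injective
  exact ⟨{ toFun := u, invFun := v
           left_inv := fun c => inj (by rw [hv, hu]; simp)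
           right_inv := fun c => inj (by rw [hu, hv]; simp)
           map_mul' := fun c d => inj (by simp [hu])
           map_add' := fun c d => inj (by simp [hu]) }, fun c => (hu c).symm⟩

/-- The restriction `τ|_F`. -/
noncomputable def restrictBase (σ : K ≃ₐ[F] K) : autStable σ →* RingAut F where
  toFun τ := τ.2.2.choose
  map_one' := by
    ext c
    apply (algebraMap F K).injective
    rw [← (1 : autStable σ).2.2.choose_spec c]
    rfl
  map_mul' τ τ' := by
    ext c
    apply (algebraMap F K).injective
    rw [← (τ * τ').2.2.choose_spec c, RingAut.mul_apply, ← τ.2.2.choose_spec,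
      ← τ'.2.2.choose_spec]
    rfl

lemma algebraMap_restrictBase {σ : K ≃ₐ[F] K} (τ : autStable σ) (c : F) :
    algebraMap F K (restrictBase σ τ c) = (τ : RingAut K) (algebraMap F K c) :=
  (τ.2.2.choose_spec c).symm

/-- The subfield `{c ∈ F | τ(c) = c}` of `F`. -/
noncomputable def fixedBase {σ : K ≃ₐ[F] K} (τ : autStable σ) : Subfield F :=
  RingHom.eqLocusField (restrictBase σ τ : F →+* F) (RingHom.id F)

variable (F K) in
/-- The group `N_{K/F}(K^×)` of nonzero norms. -/
noncomputable def normGroup : Subgroup Fˣ := (Units.map (Algebra.norm F (S := K))).range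

lemma norm_restrictBase {σ : K ≃ₐ[F] K} (τ : autStable σ) (a : K) :
    Algebra.norm F ((τ : RingAut K) a) = restrictBase σ τ (Algebra.norm F a) := by
  have h := Algebra.norm_eq_of_equiv_equiv (restrictBase σ τ) (τ : RingAut K)
    (by ext c; exact algebraMap_restrictBase τ c) a
  rw [h]
  exact ((restrictBase σ τ).apply_symm_apply _).symm

lemma map_restrictBase_mem {σ : K ≃ₐ[F] K} (τ : autStable σ) {u : Fˣ} (hu : u ∈ normGroup F K) :
    Units.mapEquiv (restrictBase σ τ).toMulEquiv u ∈ normGroup F K := by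
  obtain ⟨a, rfl⟩ := hu
  refine ⟨Units.mapEquiv (τ : RingAut K).toMulEquiv a, ?_⟩
  ext
  exact norm_restrictBase τ (a : K)

/-- The action of `Aut(K)_σ` on `N_{K/F}(K^×)`. -/
noncomputable def normGroupAction (σ : K ≃ₐ[F] K) : autStable σ →* MulAut (normGroup F K) where
  toFun τ :=
    { toFun := fun u => ⟨_, map_restrictBase_mem τ u.2⟩
      invFun := fun u => ⟨_, map_restrictBase_mem τ⁻¹ u.2⟩
      left_inv := fun u => by
        ext
        change restrictBase σ τ⁻¹ (restrictBase σ τ _) = _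
        rw [← RingAut.mul_apply, ← map_mul, inv_mul_cancel, map_one, RingAut.one_apply]
      right_inv := fun u => by
        ext
        change restrictBase σ τ (restrictBase σ τ⁻¹ _) = _
        rw [← RingAut.mul_apply, ← map_mul, mul_inv_cancel, map_one, RingAut.one_apply]
      map_mul' := fun u v => by
        ext
        exact map_mul (restrictBase σ τ) _ _ }
  map_one' := by
    ext u
    change restrictBase σ 1 _ = _
    rw [map_one]
    rfl
  map_mul' τ τ' := by
    ext u
    change restrictBase σ (τ * τ') _ = _
    rw [map_mul]
    rfl

/-- The group `G = N_{K/F}(K^×) ⋊ Aut(K)_σ` of pairs `(λ, τ)`. -/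
abbrev OrbitGroup (σ : K ≃ₐ[F] K) : Type _ :=
  SemidirectProduct (normGroup F K) (autStable σ) (normGroupAction σ)

/-- `I(F, d)`: the monic irreducible polynomials of degree `d` in `F[x]`. -/
def MonicIrred (F : Type*) [Field F] (d : ℕ) : Type _ :=
  {p : Polynomial F // p.Monic ∧ Irreducible p ∧ p.natDegree = d}

/-- `λ^{-d} p^ρ(λ x)`. -/
noncomputable def polyTwist (d : ℕ) (u : Fˣ) (ρ : RingAut F) (p : Polynomial F) : Polynomial F :=
  Polynomial.C ((u⁻¹ : Fˣ) : F) ^ d *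
    (p.map (ρ : F →+* F)).comp (Polynomial.C (u : F) * Polynomial.X)

lemma coeff_polyTwist (d : ℕ) (u : Fˣ) (ρ : RingAut F) (p : Polynomial F) (i : ℕ) :
    (polyTwist d u ρ p).coeff i = ((u⁻¹ : Fˣ) : F) ^ d * (ρ (p.coeff i) * (u : F) ^ i) := by
  rw [polyTwist, ← Polynomial.C_pow, Polynomial.coeff_C_mul, Polynomial.comp_C_mul_X_coeff,
    Polynomial.coeff_map]
  rfl

lemma natDegree_polyTwist (d : ℕ) (u : Fˣ) (ρ : RingAut F) (p : Polynomial F) :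
    (polyTwist d u ρ p).natDegree = p.natDegree := by
  have h : (polyTwist d u ρ p).support = p.support := by
    ext i
    simp [coeff_polyTwist]
  apply Polynomial.natDegree_eq_of_degree_eq
  rw [Polynomial.degree, h, Polynomial.degree]

lemma polyTwist_mem {d : ℕ} (u : Fˣ) (ρ : RingAut F) (p : MonicIrred F d) :
    (polyTwist d u ρ p.1).Monic ∧ Irreducible (polyTwist d u ρ p.1) ∧
      (polyTwist d u ρ p.1).natDegree = d := by
  obtain ⟨p, hm, hi, hd⟩ := p
  have hdeg := (natDegree_polyTwist d u ρ p).trans hd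
  refine ⟨?_, ?_, hdeg⟩
  · have hc : p.coeff d = 1 := hd ▸ hm
    rw [Polynomial.Monic, Polynomial.leadingCoeff, hdeg, coeff_polyTwist, hc]
    simp
  · rw [polyTwist, irreducible_isUnit_mul ((Polynomial.isUnit_C.2 (u⁻¹).isUnit).pow d)]
    have h1 : Irreducible (p.map (ρ : F →+* F)) :=
      (MulEquiv.irreducible_iff (Polynomial.mapEquiv ρ)).2 hi
    let _ : Invertible (u : F) := u.invertible
    have h2 := (MulEquiv.irreducible_iff (Polynomial.algEquivCMulXAddC (u : F) 0)).2 h1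
    simpa [Polynomial.comp, Polynomial.aeval_def] using h2

noncomputable instance (σ : K ≃ₐ[F] K) (d : ℕ) : MulAction (OrbitGroup σ) (MonicIrred F d) where
  smul γ p := ⟨polyTwist d (γ.left : Fˣ) (restrictBase σ γ.right) p.1, polyTwist_mem _ _ p⟩
  one_smul p := by
    apply Subtype.ext
    change polyTwist d 1 (restrictBase σ 1) p.1 = p.1
    ext i
    rw [coeff_polyTwist, map_one]
    simp
  mul_smul γ δ p := by
    apply Subtype.ext
    change polyTwist d ((γ * δ).left : Fˣ) (restrictBase σ (γ * δ).right) p.1 =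
      polyTwist d (γ.left : Fˣ) (restrictBase σ γ.right)
        (polyTwist d (δ.left : Fˣ) (restrictBase σ δ.right) p.1)
    ext i
    have hl : (((γ * δ).left : normGroup F K) : Fˣ) =
        (γ.left : Fˣ) * Units.mapEquiv (restrictBase σ γ.right).toMulEquiv (δ.left : Fˣ) := rfl
    have hr : restrictBase σ (γ * δ).right =
        restrictBase σ γ.right * restrictBase σ δ.right := map_mul _ _ _
    simp only [coeff_polyTwist, hl, hr, RingAut.mul_apply, map_mul, map_pow, mul_inv,
      Units.val_mul, mul_pow]
    rw [← map_inv]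
    simp only [Units.coe_mapEquiv, RingEquiv.toMulEquiv_eq_coe, RingEquiv.coe_toMulEquiv]
    ring

/-- The action is `p^{(λ,τ)}(x) = λ^{-d} p^τ(λ x)`. -/
lemma OrbitGroup.coe_smul {σ : K ≃ₐ[F] K} {d : ℕ} (γ : OrbitGroup σ) (p : MonicIrred F d) :
    (γ • p).1 = polyTwist d (γ.left : Fˣ) (restrictBase σ γ.right) p.1 := rfl

end Group

namespace TwistedPoly

variable {F K : Type*} [Field F] [Field K] [Algebra F K] {σ : K ≃ₐ[F] K}

/-! ### Degrees, units and left ideals -/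

/-! Two mechanisms produce the isotopies. First, the substitution sending `∑ aᵢ tⁱ` to `∑
τ(aᵢ)(αt)ⁱ` is a degree-preserving ring automorphism of `R` carrying `Rf` onto `Rf^{(α,τ)}`. It
therefore induces a ring isomorphism of Petit algebras, linear over every subfield of `F` that `τ`
fixes (`isotopicOver_twist`). Since `(αt)^{nj} = N_{K/F}(α)^j t^{nj}`, it maps `p(tⁿ)` to a scalar
multiple of `p^{(λ,τ)}(tⁿ)`, so it moves minimal central left multiples by the action of `G`
(`isMclm_twist`).

Secondly, irreducible `f` and `g` with the same minimal central left multiple `h(tⁿ)` are similar: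
`gu ∈ Rf` for some `u ∉ Rf` (`exists_mul_mem_span_of_isMclm`). Otherwise `g` acts injectively on
`R/Rf`; writing `h(tⁿ) = cg = gc`, which kills `R/Rf`, shows that `c` kills `R/Rf`. When `f` has
nonzero constant term, a nonzero annihilator of least degree is, up to a scalar, central, which
yields a central multiple of `f` of degree below that of `h(tⁿ)`. The case where `f` is a multiple
of `t` is treated directly. If moreover `deg f = deg g`, then right multiplication by `u` is a
bijection from `R/Rg` to `R/Rf`, and it is an isotopy when paired with the identity on coefficients
in the left factor (`isotopicOver_of_mul_mem_span`).

To compare `f` and `g` in the theorem, twist `f` so that its minimal central left multiple becomes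
that of `g`, then apply similarity. The division property is a dimension count: if `xu ∈ Rf` with `x
≠ 0` and `u ∉ Rf`, then `deg f ≤ deg x` (`natDegree_le_of_mul_mem`). -/

lemma coeff_sum {ι : Type*} (s : Finset ι) (f : ι → TwistedPoly σ) (i : ℕ) :
    (∑ j ∈ s, f j).coeff i = ∑ j ∈ s, (f j).coeff i :=
  map_sum (AddMonoidHom.mk' (fun f : TwistedPoly σ => f.coeff i) fun a b => coeff_add a b i) f s

lemma coeff_monomial_mul (i : ℕ) (a : K) (f : TwistedPoly σ) (k : ℕ) :
    (monomial σ i a * f).coeff k = if i ≤ k then a * (σ ^ i) (f.coeff (k - i)) else 0 := by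
  rw [coeff_mul]
  split_ifs with h
  · rw [Finset.sum_eq_single (i, k - i)]
    · rw [coeff_monomial, if_pos rfl]
    · rintro ⟨x, y⟩ hxy hne
      rw [Finset.HasAntidiagonal.mem_antidiagonal] at hxy
      rw [coeff_monomial, if_neg, zero_mul]
      rintro rfl
      exact hne (by ext <;> simp at hxy ⊢; omega)
    · intro h'
      exact absurd (Finset.HasAntidiagonal.mem_antidiagonal.2 (by simp; omega)) h'
  · refine Finset.sum_eq_zero ?_
    rintro ⟨x, y⟩ hxy
    rw [Finset.HasAntidiagonal.mem_antidiagonal] at hxy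
    rw [coeff_monomial, if_neg, zero_mul]
    simp only at hxy ⊢
    omega

lemma coeff_mul_monomial (i : ℕ) (a : K) (f : TwistedPoly σ) (k : ℕ) :
    (f * monomial σ i a).coeff k =
      if i ≤ k then f.coeff (k - i) * (σ ^ (k - i)) a else 0 := by
  rw [coeff_mul]
  split_ifs with h
  · rw [Finset.sum_eq_single (k - i, i)]
    · rw [coeff_monomial, if_pos rfl]
    · rintro ⟨x, y⟩ hxy hne
      rw [Finset.HasAntidiagonal.mem_antidiagonal] at hxy
      rw [coeff_monomial, if_neg, map_zero, mul_zero]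
      rintro rfl
      exact hne (by ext <;> simp at hxy ⊢; omega)
    · intro h'
      exact absurd (Finset.HasAntidiagonal.mem_antidiagonal.2 (by simp; omega)) h'
  · refine Finset.sum_eq_zero ?_
    rintro ⟨x, y⟩ hxy
    rw [Finset.HasAntidiagonal.mem_antidiagonal] at hxy
    rw [coeff_monomial, if_neg, map_zero, mul_zero]
    simp only at hxy ⊢
    omega

lemma smul_eq_monomial_mul (a : K) (f : TwistedPoly σ) : a • f = monomial σ 0 a * f := by
  refine ext fun i => ?_
  rw [coeff_smul, coeff_monomial_mul]
  simp

lemma smul_mul (a : K) (f g : TwistedPoly σ) : (a • f) * g = a • (f * g) := by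
  rw [smul_eq_monomial_mul, smul_eq_monomial_mul, mul_assoc]

lemma mul_algebraMap_smul (f g : TwistedPoly σ) (c : F) :
    f * (algebraMap F K c • g) = algebraMap F K c • (f * g) := by
  refine ext fun i => ?_
  rw [coeff_smul, coeff_mul, coeff_mul, Finset.mul_sum]
  refine Finset.sum_congr rfl fun p _ => ?_
  rw [coeff_smul, map_mul, AlgEquiv.commutes]
  ring

lemma coeff_one (i : ℕ) : (1 : TwistedPoly σ).coeff i = if i = 0 then 1 else 0 := by
  let _ := twistAction σ
  have h : (1 : TwistedPoly σ) = monomial σ 0 1 := rfl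
  rw [h, coeff_monomial]
  simp only [eq_comm]

lemma one_eq_monomial : (1 : TwistedPoly σ) = monomial σ 0 1 :=
  ext fun i => by rw [coeff_one, coeff_monomial]; simp only [eq_comm]

lemma exists_coeff_eq (N : ℕ) (c : ℕ → K) (hc : ∀ i, N ≤ i → c i = 0) :
    ∃ f : TwistedPoly σ, ∀ i, f.coeff i = c i := by
  refine ⟨∑ i ∈ Finset.range N, monomial σ i (c i), fun i => ?_⟩
  rw [coeff_sum]
  simp only [coeff_monomial, Finset.sum_ite_eq', Finset.mem_range]
  split_ifs with h
  · rfl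
  · exact (hc i (not_lt.1 h)).symm

lemma natDegree_le_iff {f : TwistedPoly σ} {N : ℕ} :
    f.natDegree ≤ N ↔ ∀ i, N < i → f.coeff i = 0 := by
  refine ⟨fun h i hi => coeff_eq_zero_of_natDegree_lt (by omega), fun h => ?_⟩
  refine Finset.sup_le fun i hi => ?_
  by_contra hN
  exact mem_support.1 hi (h i (not_le.1 hN))

lemma le_natDegree {f : TwistedPoly σ} {i : ℕ} (h : f.coeff i ≠ 0) : i ≤ f.natDegree := by
  by_contra hc
  exact h (coeff_eq_zero_of_natDegree_lt (not_le.1 hc))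

lemma natDegree_lt_of_mem_degreeLT {f : TwistedPoly σ} {m : ℕ} (h : f ∈ degreeLT σ m)
    (hf : f ≠ 0) : f.natDegree < m := by
  by_contra hc
  exact coeff_natDegree_ne_zero hf (h _ (not_lt.1 hc))

lemma mem_degreeLT_of_natDegree_lt {f : TwistedPoly σ} {m : ℕ} (h : f.natDegree < m) :
    f ∈ degreeLT σ m := fun _ hi => coeff_eq_zero_of_natDegree_lt (by omega)

lemma coeff_mul_natDegree_add (f g : TwistedPoly σ) :
    (f * g).coeff (f.natDegree + g.natDegree) =
      f.coeff f.natDegree * (σ ^ f.natDegree) (g.coeff g.natDegree) := by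
  rw [coeff_mul, Finset.sum_eq_single (f.natDegree, g.natDegree)]
  · rintro ⟨a, b⟩ hab hne
    rw [Finset.HasAntidiagonal.mem_antidiagonal] at hab
    simp only at hab ⊢
    by_cases ha : f.natDegree < a
    · rw [coeff_eq_zero_of_natDegree_lt ha, zero_mul]
    · have hb : g.natDegree < b := by
        rcases eq_or_ne a f.natDegree with rfl | hne'
        · exact absurd (by ext <;> simp; omega) hne
        · omega
      rw [coeff_eq_zero_of_natDegree_lt hb, map_zero, mul_zero]
  · simp

lemma coeff_mul_natDegree_add_ne_zero {f g : TwistedPoly σ} (hf : f ≠ 0) (hg : g ≠ 0) :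
    (f * g).coeff (f.natDegree + g.natDegree) ≠ 0 := by
  rw [coeff_mul_natDegree_add]
  exact mul_ne_zero (coeff_natDegree_ne_zero hf) ((map_ne_zero _).2 (coeff_natDegree_ne_zero hg))

instance : NoZeroDivisors (TwistedPoly σ) where
  eq_zero_or_eq_zero_of_mul_eq_zero {f g} h := by
    by_contra! hc
    exact coeff_mul_natDegree_add_ne_zero hc.1 hc.2 (by rw [h, coeff_zero])

instance : Nontrivial (TwistedPoly σ) where
  exists_pair_ne := ⟨1, 0, fun h => one_ne_zero (α := K) <| by
    simpa [coeff_one, coeff_zero] using congrArg (fun f => coeff f 0) h⟩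

instance : IsDomain (TwistedPoly σ) := NoZeroDivisors.to_isDomain _

lemma natDegree_mul {f g : TwistedPoly σ} (hf : f ≠ 0) (hg : g ≠ 0) :
    (f * g).natDegree = f.natDegree + g.natDegree := by
  refine le_antisymm (natDegree_le_iff.2 fun i hi => ?_)
    (le_natDegree (coeff_mul_natDegree_add_ne_zero hf hg))
  rw [coeff_mul]
  refine Finset.sum_eq_zero ?_
  rintro ⟨a, b⟩ hab
  rw [Finset.HasAntidiagonal.mem_antidiagonal] at hab
  simp only at hab ⊢
  by_cases ha : f.natDegree < a
  · rw [coeff_eq_zero_of_natDegree_lt ha, zero_mul]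
  · rw [coeff_eq_zero_of_natDegree_lt (f := g) (by omega), map_zero, mul_zero]

lemma natDegree_one : (1 : TwistedPoly σ).natDegree = 0 :=
  Nat.le_zero.1 (natDegree_le_iff.2 fun i hi => by rw [coeff_one, if_neg hi.ne'])

lemma monomial_zero_mul_monomial_zero (a b : K) :
    monomial σ 0 a * monomial σ 0 b = monomial σ 0 (a * b) := by
  refine ext fun i => ?_
  rw [coeff_monomial_mul]
  simp [coeff_monomial]

lemma isUnit_monomial_zero {a : K} (ha : a ≠ 0) : IsUnit (monomial σ 0 a) :=
  ⟨⟨monomial σ 0 a, monomial σ 0 a⁻¹,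
    by rw [monomial_zero_mul_monomial_zero, mul_inv_cancel₀ ha, one_eq_monomial],
    by rw [monomial_zero_mul_monomial_zero, inv_mul_cancel₀ ha, one_eq_monomial]⟩, rfl⟩

lemma isUnit_iff {f : TwistedPoly σ} : IsUnit f ↔ f ≠ 0 ∧ f.natDegree = 0 := by
  constructor
  · rintro ⟨u, rfl⟩
    refine ⟨u.ne_zero, ?_⟩
    have h := congrArg natDegree u.mul_inv
    rw [natDegree_mul u.ne_zero u⁻¹.ne_zero, natDegree_one] at h
    omega
  · rintro ⟨h0, hd⟩
    have h : f = monomial σ 0 (f.coeff 0) := by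
      refine ext fun i => ?_
      rw [coeff_monomial]
      split_ifs with h
      · rw [h]
      · exact coeff_eq_zero_of_natDegree_lt (by omega)
    rw [h]
    exact isUnit_monomial_zero (hd ▸ coeff_natDegree_ne_zero h0)

lemma natDegree_pos_of_irreducible {f : TwistedPoly σ} (hf : Irreducible f) : 0 < f.natDegree :=
  Nat.pos_of_ne_zero fun h => hf.not_isUnit (isUnit_iff.2 ⟨hf.ne_zero, h⟩)

lemma natDegree_smul {a : K} (ha : a ≠ 0) (f : TwistedPoly σ) :
    (a • f).natDegree = f.natDegree := by
  have h : (a • f).support = f.support := by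
    ext i
    simp [mem_support, coeff_smul, ha]
  rw [natDegree, natDegree, h]

/-- Ideals here are left ideals, so `Ideal.span {f}` is `Rf`. -/
lemma mem_span_iff {f g : TwistedPoly σ} : g ∈ Ideal.span {f} ↔ ∃ q, g = q * f := by
  rw [Ideal.mem_span_singleton']
  simp only [eq_comm]

lemma smul_mem_left {I : Ideal (TwistedPoly σ)} {f : TwistedPoly σ} (a : K) (hf : f ∈ I) :
    a • f ∈ I := by
  rw [smul_eq_monomial_mul]
  exact I.mul_mem_left _ hf

lemma natDegree_le_of_mem_span {f g : TwistedPoly σ} (h : g ∈ Ideal.span {f}) (hg : g ≠ 0) :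
    f.natDegree ≤ g.natDegree := by
  obtain ⟨q, rfl⟩ := mem_span_iff.1 h
  rw [natDegree_mul (left_ne_zero_of_mul hg) (right_ne_zero_of_mul hg)]
  omega

lemma exists_eq_span_singleton (I : Ideal (TwistedPoly σ)) : ∃ d, I = Ideal.span {d} := by
  classical
  by_cases hI : ∃ f ∈ I, f ≠ 0
  · have hex : ∃ k, ∃ f ∈ I, f ≠ 0 ∧ f.natDegree = k := by
      obtain ⟨f, hf, h0⟩ := hI
      exact ⟨_, f, hf, h0, rfl⟩
    obtain ⟨d, hd, hd0, hdeg⟩ := Nat.find_spec hex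
    -- A nonzero element of least degree generates, because right division by it leaves a remainder
    -- in the ideal.
    refine ⟨d, le_antisymm (fun g hg => ?_) ((Ideal.span_singleton_le_iff_mem _).2 hd)⟩
    obtain ⟨r, hr, q, hq⟩ := exists_right_division hd0 g
    have hrI : r ∈ I := by
      have : r = g - q * d := by rw [hq]; abel
      exact this ▸ I.sub_mem hg (I.mul_mem_left _ hd)
    by_cases hr0 : r = 0
    · exact mem_span_iff.2 ⟨q, by rw [hq, hr0, add_zero]⟩
    · exact absurd (natDegree_lt_of_mem_degreeLT hr hr0)
        (by rw [hdeg]; exact not_lt.2 (Nat.find_min' hex ⟨r, hrI, hr0, rfl⟩))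
  · push Not at hI
    refine ⟨0, ?_⟩
    ext g
    rw [mem_span_iff]
    refine ⟨fun h => ⟨0, by rw [hI g h, zero_mul]⟩, ?_⟩
    rintro ⟨q, rfl⟩
    rw [mul_zero]
    exact I.zero_mem

/-- An irreducible twisted polynomial generates a maximal left ideal. -/
lemma exists_bezout {f u : TwistedPoly σ} (hf : Irreducible f) (hu : u ∉ Ideal.span {f})
    (w : TwistedPoly σ) : ∃ a b, w = a * u + b * f := by
  obtain ⟨d, hd⟩ := exists_eq_span_singleton (Ideal.span {u, f})
  have hfd : f ∈ Ideal.span {d} := hd ▸ Ideal.subset_span (by simp)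
  have hud : u ∈ Ideal.span {d} := hd ▸ Ideal.subset_span (by simp)
  obtain ⟨c, hc⟩ := mem_span_iff.1 hfd
  have hw : w ∈ Ideal.span {u, f} := by
    rw [hd]
    -- With `f = cd`: if `c` is a unit, then `d`, and hence `u`, lies in `Rf`, against `hu`; so `d`
    -- is a unit and the ideal is everything.
    rcases hf.isUnit_or_isUnit hc with h | h
    · obtain ⟨v, rfl⟩ := h
      obtain ⟨e, he⟩ := mem_span_iff.1 hud
      refine absurd (mem_span_iff.2 ⟨e * ((v⁻¹ : (TwistedPoly σ)ˣ) : TwistedPoly σ), ?_⟩) hu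
      rw [hc, mul_assoc, Units.inv_mul_cancel_left, he]
    · obtain ⟨v, rfl⟩ := h
      exact mem_span_iff.2 ⟨w * ((v⁻¹ : (TwistedPoly σ)ˣ) : TwistedPoly σ),
        by rw [mul_assoc, v.inv_mul, mul_one]⟩
  obtain ⟨a, b, h⟩ := Ideal.mem_span_pair.1 hw
  exact ⟨a, b, h.symm⟩

/-! ### Remainders -/

lemma sub_modRight_mem (g : TwistedPoly σ) {f : TwistedPoly σ} (hf : f ≠ 0) :
    g - (modRight g f : TwistedPoly σ) ∈ Ideal.span {f} := by
  obtain ⟨q, hq⟩ := modRight_spec g hf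
  exact mem_span_iff.2 ⟨q, by rw [sub_eq_iff_eq_add]; exact hq⟩

lemma modRight_eq_of_sub_mem {f g : TwistedPoly σ} (hf : f ≠ 0) {r : degreeLT σ f.natDegree}
    (h : g - r ∈ Ideal.span {f}) : modRight g f = r := by
  obtain ⟨q, hq⟩ := mem_span_iff.1 h
  exact modRight_eq hf (sub_eq_iff_eq_add.1 hq)

lemma modRight_eq_modRight_iff {f g g' : TwistedPoly σ} (hf : f ≠ 0) :
    modRight g f = modRight g' f ↔ g - g' ∈ Ideal.span {f} := by
  constructor
  · intro h
    have h1 := sub_modRight_mem g hf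
    rw [h] at h1
    have h2 := Ideal.sub_mem _ h1 (sub_modRight_mem g' hf)
    simpa using h2
  · intro h
    refine modRight_eq_of_sub_mem hf ?_
    have h2 := Ideal.add_mem _ h (sub_modRight_mem g' hf)
    simpa using h2

lemma modRight_eq_zero_iff {f g : TwistedPoly σ} (hf : f ≠ 0) :
    modRight g f = 0 ↔ g ∈ Ideal.span {f} := by
  rw [← modRight_zero f, modRight_eq_modRight_iff hf, sub_zero]

lemma modRight_smul (a : K) (g f : TwistedPoly σ) :
    modRight (a • g) f = a • modRight g f := by
  by_cases hf : f = 0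
  · simp [modRight, hf]
  · refine modRight_eq_of_sub_mem hf ?_
    rw [Submodule.coe_smul, ← smul_sub]
    exact smul_mem_left a (sub_modRight_mem g hf)

lemma eq_zero_of_mem_degreeLT_of_mem_span {f g : TwistedPoly σ}
    (hg : g ∈ degreeLT σ f.natDegree) (h : g ∈ Ideal.span {f}) : g = 0 := by
  by_contra h0
  have := natDegree_le_of_mem_span h h0
  have := natDegree_lt_of_mem_degreeLT hg h0
  omega

/-- The coefficients of a polynomial of degree less than `m`. -/
noncomputable def degreeLTEquiv (σ : K ≃ₐ[F] K) (m : ℕ) : degreeLT σ m ≃ₗ[K] (Fin m → K) :=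
  LinearEquiv.ofBijective
    ({ toFun := fun f i => f.1.coeff i
       map_add' := fun f g => funext fun i => coeff_add f.1 g.1 i
       map_smul' := fun a f => funext fun i => coeff_smul a f.1 i } :
      degreeLT σ m →ₗ[K] (Fin m → K))
    ⟨fun f g h => Subtype.ext <| ext fun i => by
      by_cases hi : i < m
      · exact congrFun h ⟨i, hi⟩
      · rw [f.2 i (not_lt.1 hi), g.2 i (not_lt.1 hi)],
    fun c => by
      obtain ⟨f, hf⟩ := exists_coeff_eq (σ := σ) m (fun i => if h : i < m then c ⟨i, h⟩ else 0)
        fun i hi => dif_neg (not_lt.2 hi)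
      refine ⟨⟨f, fun i hi => by rw [hf, dif_neg (not_lt.2 hi)]⟩, funext fun i => ?_⟩
      change f.coeff i = c i
      rw [hf, dif_pos i.2]⟩

instance (m : ℕ) : FiniteDimensional K (degreeLT σ m) :=
  (degreeLTEquiv σ m).symm.finiteDimensional

lemma finrank_degreeLT (m : ℕ) : Module.finrank K (degreeLT σ m) = m := by
  rw [(degreeLTEquiv σ m).finrank_eq, Module.finrank_fin_fun]

/-- Right multiplication by `u` modulo `f`, on polynomials of degree less than `k`. -/
noncomputable def rightMulMod (k : ℕ) (u f : TwistedPoly σ) :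
    degreeLT σ k →ₗ[K] degreeLT σ f.natDegree where
  toFun z := modRight (z.1 * u) f
  map_add' x y := by rw [Submodule.coe_add, add_mul, modRight_add]
  map_smul' a x := by
    rw [Submodule.coe_smul, smul_mul, modRight_smul]
    rfl

/-- Since `Ru + Rf = R`, every class modulo `Rf` is that of some `au`. Replacing `a` by its
remainder modulo `x` changes `au` only by a left multiple of `xu`, which lies in `Rf`. -/
lemma rightMulMod_surjective {f u x : TwistedPoly σ} (hf : Irreducible f)
    (hu : u ∉ Ideal.span {f}) (hx : x ≠ 0) (hxu : x * u ∈ Ideal.span {f}) :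
    Function.Surjective (rightMulMod x.natDegree u f) := by
  intro w
  obtain ⟨a, b, hab⟩ := exists_bezout hf hu w.1
  obtain ⟨r, hr, q, rfl⟩ := exists_right_division hx a
  refine ⟨⟨r, hr⟩, modRight_eq_of_sub_mem hf.ne_zero ?_⟩
  have h : r * u - w.1 = -(q * (x * u)) - b * f := by
    rw [hab, add_mul, mul_assoc]
    abel
  rw [h]
  exact Ideal.sub_mem _ (neg_mem (Ideal.mul_mem_left _ _ hxu))
    (Ideal.mul_mem_left _ _ (Ideal.mem_span_singleton_self f))

/-- Every nonzero `x` killing a nonzero element of `R/Rf` has degree at least `deg f`. -/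
lemma natDegree_le_of_mul_mem {f u x : TwistedPoly σ} (hf : Irreducible f)
    (hu : u ∉ Ideal.span {f}) (hx : x ≠ 0) (hxu : x * u ∈ Ideal.span {f}) :
    f.natDegree ≤ x.natDegree := by
  -- The source has `K`-dimension `deg x`, the target `deg f`.
  have h := LinearMap.finrank_le_finrank_of_surjective (rightMulMod_surjective hf hu hx hxu)
  rwa [finrank_degreeLT, finrank_degreeLT] at h

end TwistedPoly

/-! ### Petit algebras of irreducible polynomials are division rings -/

namespace Petit

open TwistedPoly

variable {F K : Type*} [Field F] [Field K] [Algebra F K] {σ : K ≃ₐ[F] K} {f : TwistedPoly σ}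

instance : FiniteDimensional K (Petit f) :=
  inferInstanceAs (FiniteDimensional K (degreeLT σ f.natDegree))

instance : IsScalarTower F K (Petit f) where
  smul_assoc c a x := by
    rw [Algebra.smul_def, mul_smul]
    rfl

instance [FiniteDimensional F K] : FiniteDimensional F (Petit f) := Module.Finite.trans K _

lemma toPoly_algebraMap_smul (c : F) (x : Petit f) :
    (c • x).toPoly = algebraMap F K c • x.toPoly := rfl

lemma toPoly_injective : Function.Injective (toPoly : Petit f → TwistedPoly σ) :=
  Subtype.val_injective

lemma toPoly_mem (x : Petit f) : x.toPoly ∈ degreeLT σ f.natDegree := x.2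

lemma toPoly_notMem_span {x : Petit f} (hx : x ≠ 0) : x.toPoly ∉ Ideal.span {f} := fun h =>
  hx (toPoly_injective (eq_zero_of_mem_degreeLT_of_mem_span x.toPoly_mem h))

/-- Left multiplication by `a` on `R/Rf`. -/
noncomputable def leftMulMod (a f : TwistedPoly σ) : Petit f →ₗ[F] Petit f where
  toFun x := modRight (a * x.toPoly) f
  map_add' x y := by
    rw [toPoly_add, mul_add, modRight_add]
    rfl
  map_smul' c x := by
    rw [toPoly_algebraMap_smul, mul_algebraMap_smul, modRight_smul]
    rfl

lemma leftMulMod_bijective [FiniteDimensional F K] {a : TwistedPoly σ} (hf : f ≠ 0)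
    (ha : ∀ v, a * v ∈ Ideal.span {f} → v ∈ Ideal.span {f}) :
    Function.Bijective (leftMulMod a f) := by
  have hinj : Function.Injective (leftMulMod a f) := by
    refine (injective_iff_map_eq_zero _).2 fun x hx => ?_
    by_contra h0
    exact toPoly_notMem_span h0 (ha _ ((modRight_eq_zero_iff hf).1 hx))
  exact ⟨hinj, LinearMap.injective_iff_surjective.1 hinj⟩

/-- If `a` acts injectively on `R/Rf`, then it acts surjectively. -/
lemma exists_sub_mul_mem [FiniteDimensional F K] {a : TwistedPoly σ} (hf : f ≠ 0)
    (ha : ∀ v, a * v ∈ Ideal.span {f} → v ∈ Ideal.span {f}) (w : TwistedPoly σ) :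
    ∃ v, w - a * v ∈ Ideal.span {f} := by
  obtain ⟨x, hx⟩ := (leftMulMod_bijective hf ha).2 (modRight w f)
  exact ⟨x.toPoly, (modRight_eq_modRight_iff hf).1 hx.symm⟩

/-- The degree bound excludes zero divisors, as representatives have degree below `deg f`.
Injectivity then gives bijectivity by finite dimension: over `F` for left multiplications, which are
only `F`-linear, and over `K` for right ones. -/
theorem isNonassocDivisionRing [FiniteDimensional F K] (hf : Irreducible f) :
    IsNonassocDivisionRing (Petit f) := by
  have key : ∀ x y : Petit f, x ≠ 0 → y ≠ 0 → x.toPoly * y.toPoly ∉ Ideal.span {f} := by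
    intro x y hx hy h
    have hx0 : x.toPoly ≠ 0 := fun h => hx (toPoly_injective h)
    have h1 := natDegree_le_of_mul_mem hf (toPoly_notMem_span hy) hx0 h
    have h2 := natDegree_lt_of_mem_degreeLT x.toPoly_mem hx0
    omega
  refine ⟨⟨⟨⟨1, mem_degreeLT_of_natDegree_lt ?_⟩, 0, ?_⟩⟩, fun a ha => ⟨?_, ?_⟩⟩
  · rw [natDegree_one]
    exact natDegree_pos_of_irreducible hf
  · exact fun h => one_ne_zero (congrArg Subtype.val h)
  · have ha0 : a.toPoly ≠ 0 := fun h => ha (toPoly_injective h)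
    refine leftMulMod_bijective (a := a.toPoly) hf.ne_zero fun v hv => ?_
    by_contra hv'
    have h1 := natDegree_le_of_mul_mem hf hv' ha0 hv
    have h2 := natDegree_lt_of_mem_degreeLT a.toPoly_mem ha0
    omega
  · have hinj : Function.Injective (rightMulMod f.natDegree a.toPoly f) := by
      refine (injective_iff_map_eq_zero _).2 fun x hx => ?_
      by_contra h0
      exact key x a h0 ha ((modRight_eq_zero_iff hf.ne_zero).1 hx)
    exact ⟨hinj, LinearMap.injective_iff_surjective.1 hinj⟩

end Petit

namespace TwistedPoly

variable {F K : Type*} [Field F] [Field K] [Algebra F K] {σ : K ≃ₐ[F] K}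

/-! ### The action of `t` -/

lemma exists_eq_mul_monomial_one {f : TwistedPoly σ} (hf : f.coeff 0 = 0) :
    ∃ g, f = g * monomial σ 1 1 := by
  obtain ⟨g, hg⟩ := exists_coeff_eq (σ := σ) (f.natDegree + 1) (fun i => f.coeff (i + 1))
    fun i hi => coeff_eq_zero_of_natDegree_lt (by omega)
  refine ⟨g, ext fun i => ?_⟩
  rw [coeff_mul_monomial]
  rcases i with _ | i
  · simpa using hf
  · simp [hg]

lemma exists_eq_monomial_one_mul {f : TwistedPoly σ} (hf : f.coeff 0 = 0) :
    ∃ g, f = monomial σ 1 1 * g := by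
  obtain ⟨g, hg⟩ := exists_coeff_eq (σ := σ) (f.natDegree + 1)
    -- Moving `t` to the left past a coefficient applies `σ`, so the coefficients of the cofactor
    -- are untwisted.
    (fun i => σ.symm (f.coeff (i + 1)))
    fun i hi => by rw [coeff_eq_zero_of_natDegree_lt (by omega), map_zero]
  refine ⟨g, ext fun i => ?_⟩
  rw [coeff_monomial_mul]
  rcases i with _ | i
  · simpa using hf
  · simp [hg]

lemma coeff_mul_zero (f g : TwistedPoly σ) : (f * g).coeff 0 = f.coeff 0 * g.coeff 0 := by
  rw [coeff_mul]
  simp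

lemma monomial_one_ne_zero : monomial σ 1 1 ≠ 0 := fun h => by
  have := congrArg (fun f => coeff f 1) h
  simp [coeff_monomial, coeff_zero] at this

lemma natDegree_monomial_one : (monomial σ 1 (1 : K)).natDegree = 1 :=
  le_antisymm (natDegree_le_iff.2 fun i hi => by rw [coeff_monomial, if_neg (by omega)])
    (le_natDegree (by simp [coeff_monomial]))

/-- If `f` has nonzero constant coefficient, then `t` acts injectively on `R/Rf`. -/
lemma mem_span_of_monomial_one_mul_mem {f : TwistedPoly σ} (hf : f.coeff 0 ≠ 0)
    (u : TwistedPoly σ) (hu : monomial σ 1 1 * u ∈ Ideal.span {f}) : u ∈ Ideal.span {f} := by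
  obtain ⟨q, hq⟩ := mem_span_iff.1 hu
  -- In `tu = qf` the left side has zero constant term and `f` does not, so `q` is divisible by `t`
  -- on the left and `t` cancels.
  have h0 : q.coeff 0 = 0 := by
    have := congrArg (fun f => coeff f 0) hq
    simp only [coeff_mul_zero, coeff_monomial] at this
    simpa [hf] using this.symm
  obtain ⟨q, rfl⟩ := exists_eq_monomial_one_mul h0
  rw [mul_assoc] at hq
  exact mem_span_iff.2 ⟨q, mul_left_cancel₀ monomial_one_ne_zero hq⟩

/-- Zero constant term means `f = gt`, and `t` is not a unit, so `g` is a nonzero constant. -/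
lemma exists_eq_smul_monomial_one {f : TwistedPoly σ} (hf : Irreducible f)
    (h0 : f.coeff 0 = 0) : ∃ a : K, a ≠ 0 ∧ f = a • monomial σ 1 1 := by
  obtain ⟨g, hg⟩ := exists_eq_mul_monomial_one h0
  have hgu : IsUnit g := (hf.isUnit_or_isUnit hg).resolve_right fun h => by
    have := (isUnit_iff.1 h).2
    rw [natDegree_monomial_one] at this
    exact one_ne_zero this
  obtain ⟨hg0, hgd⟩ := isUnit_iff.1 hgu
  refine ⟨g.coeff 0, hgd ▸ coeff_natDegree_ne_zero hg0, ?_⟩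
  rw [hg, smul_eq_monomial_mul]
  congr 1
  refine ext fun i => ?_
  rw [coeff_monomial]
  split_ifs with h
  · rw [h]
  · exact coeff_eq_zero_of_natDegree_lt (by omega)

/-! ### Central polynomials -/

lemma central_X : central σ Polynomial.X = monomial σ (Module.finrank F K) 1 := by
  rw [central, Polynomial.sum_X_index (by simp [monomial]; rfl), mul_one, map_one]

section Central

variable [FiniteDimensional F K]

lemma coeff_central (p : Polynomial F) (k : ℕ) :
    (central σ p).coeff k =
      if Module.finrank F K ∣ k then algebraMap F K (p.coeff (k / Module.finrank F K)) else 0 := by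
  have hn : 0 < Module.finrank F K := Module.finrank_pos
  rw [central, Polynomial.sum_def, coeff_sum]
  simp only [coeff_monomial]
  split_ifs with h
  · obtain ⟨j, rfl⟩ := h
    simp only [Nat.mul_div_cancel_left j hn, Nat.mul_right_inj hn.ne', Finset.sum_ite_eq']
    split_ifs with h
    · rfl
    · rw [Polynomial.notMem_support_iff.1 h, map_zero]
  · refine Finset.sum_eq_zero fun i _ => if_neg ?_
    rintro rfl
    exact h (dvd_mul_right _ _)

lemma coeff_central_mul (p : Polynomial F) (j : ℕ) :
    (central σ p).coeff (Module.finrank F K * j) = algebraMap F K (p.coeff j) := by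
  rw [coeff_central, if_pos (dvd_mul_right _ _), Nat.mul_div_cancel_left _ Module.finrank_pos]

lemma central_ne_zero {p : Polynomial F} (hp : p ≠ 0) : central σ p ≠ 0 := by
  intro h
  have := coeff_central_mul (σ := σ) p p.natDegree
  rw [h, coeff_zero, eq_comm, map_eq_zero] at this
  exact hp (Polynomial.leadingCoeff_eq_zero.1 this)

lemma natDegree_central_le (p : Polynomial F) :
    (central σ p).natDegree ≤ Module.finrank F K * p.natDegree := by
  refine natDegree_le_iff.2 fun i hi => ?_
  rw [coeff_central]
  split_ifs with h
  · obtain ⟨j, rfl⟩ := h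
    rw [Nat.mul_div_cancel_left _ Module.finrank_pos, Polynomial.coeff_eq_zero_of_natDegree_lt
      (lt_of_mul_lt_mul_left' hi), map_zero]
  · rfl

lemma natDegree_pos_of_isMclm {f : TwistedPoly σ} {h : Polynomial F} (hf : Irreducible f)
    (hfh : f.IsMclm h) : 0 < h.natDegree := by
  obtain ⟨⟨hm, q, hq⟩, -⟩ := hfh
  have h1 := natDegree_le_of_mem_span (mem_span_iff.2 ⟨q, hq⟩) (central_ne_zero hm.ne_zero)
  have h2 := natDegree_central_le (σ := σ) h
  have h3 := natDegree_pos_of_irreducible hf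
  exact Nat.pos_of_ne_zero fun h0 => by rw [h0, mul_zero] at h2; omega

/-- Here `f` is a scalar times `t`, so `tⁿ ∈ Rf` and minimality forces `h = X`. Then `tⁿ ∈ Rg`; if
`g` had nonzero constant term, cancelling powers of `t` modulo `Rg` would give `1 ∈ Rg`. -/
lemma coeff_zero_eq_zero_of_isMclm {f g : TwistedPoly σ} {h : Polynomial F} (hf : Irreducible f)
    (hg : Irreducible g) (hfh : f.IsMclm h) (hgh : g.IsMclm h) (h0 : f.coeff 0 = 0) :
    g.coeff 0 = 0 := by
  obtain ⟨a, ha, rfl⟩ := exists_eq_smul_monomial_one hf h0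
  have hn : 0 < Module.finrank F K := Module.finrank_pos
  have hpos := natDegree_pos_of_isMclm hf hfh
  have hle : h.natDegree ≤ 1 := by
    rw [← Polynomial.natDegree_X (R := F)]
    refine hfh.2 _ Polynomial.monic_X ?_
    obtain ⟨q, hq⟩ := exists_eq_mul_monomial_one (f := central σ (Polynomial.X : Polynomial F)) (by
      rw [central_X, coeff_monomial, if_neg hn.ne'])
    refine ⟨q * monomial σ 0 a⁻¹, ?_⟩
    rw [hq, smul_eq_monomial_mul, mul_assoc, ← mul_assoc (monomial σ 0 a⁻¹),
      monomial_zero_mul_monomial_zero, inv_mul_cancel₀ ha, ← one_eq_monomial, one_mul]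
  have hc0 : (central σ h).coeff 0 = 0 := by
    obtain ⟨⟨-, q, hq⟩, -⟩ := hfh
    rw [hq, coeff_mul_zero, h0, mul_zero]
  by_contra hg0
  obtain ⟨⟨hm, q, hq⟩, -⟩ := hgh
  have hX : h = Polynomial.X := by
    have h1 : h.natDegree = 1 := by omega
    have h2 : h.coeff 0 = 0 := by
      apply (algebraMap F K).injective
      rw [← coeff_central_mul (σ := σ), mul_zero, hc0, map_zero]
    rw [hm.eq_X_add_C h1, h2, Polynomial.C_0, add_zero]
  have hpow : ∀ k, monomial σ k 1 ∉ Ideal.span {g} := by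
    intro k
    induction k with
    | zero =>
      rw [← one_eq_monomial]
      intro h1
      obtain ⟨q, hq⟩ := mem_span_iff.1 h1
      exact hg.not_isUnit (IsUnit.of_mul_eq_one_right q hq.symm)
    | succ k ih =>
      intro h1
      refine ih (mem_span_of_monomial_one_mul_mem hg0 _ ?_)
      have : monomial σ 1 1 * monomial σ k 1 = monomial σ (k + 1) 1 := by
        refine ext fun i => ?_
        rw [coeff_monomial_mul, coeff_monomial, coeff_monomial]
        rcases i with _ | i
        · simp
        · by_cases hk : k = i <;> simp [hk]
      rwa [this]
  refine hpow (Module.finrank F K) ?_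
  rw [← central_X, ← hX]
  exact mem_span_iff.2 ⟨q, hq⟩

variable [IsGalois F K]

lemma orderOf_eq_finrank (hσ : ∀ ρ : K ≃ₐ[F] K, ρ ∈ Subgroup.zpowers σ) :
    orderOf σ = Module.finrank F K := by
  rw [← IsGalois.card_aut_eq_finrank F K, orderOf_eq_card_of_forall_mem_zpowers hσ]

lemma pow_finrank_mul (hσ : ∀ ρ : K ≃ₐ[F] K, ρ ∈ Subgroup.zpowers σ) (i : ℕ) :
    σ ^ (Module.finrank F K * i) = 1 := by
  rw [← orderOf_eq_finrank hσ, pow_mul, pow_orderOf_eq_one, one_pow]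

/-- Powers of `tⁿ` commute with `K` because `σⁿ = 1`, and coefficients from `F` commute with `t`
because `σ` fixes them. -/
lemma central_mul_comm (hσ : ∀ ρ : K ≃ₐ[F] K, ρ ∈ Subgroup.zpowers σ) (p : Polynomial F)
    (g : TwistedPoly σ) : central σ p * g = g * central σ p := by
  rw [central, Polynomial.sum_def, Finset.sum_mul, Finset.mul_sum]
  refine Finset.sum_congr rfl fun i _ => ext fun k => ?_
  rw [coeff_monomial_mul, coeff_mul_monomial, pow_finrank_mul hσ, AlgEquiv.commutes]
  split_ifs
  · rw [mul_comm]; rfl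
  · rfl

lemma exists_algebraMap_eq (hσ : ∀ ρ : K ≃ₐ[F] K, ρ ∈ Subgroup.zpowers σ) {a : K}
    (ha : σ a = a) : ∃ c : F, algebraMap F K c = a := by
  refine (IsGalois.mem_range_algebraMap_iff_fixed a).2 fun ρ => ?_
  have : σ ∈ MulAction.stabilizer (K ≃ₐ[F] K) a := ha
  exact (Subgroup.zpowers_le.2 this) (hσ ρ)

lemma exists_central_eq (hσ : ∀ ρ : K ≃ₐ[F] K, ρ ∈ Subgroup.zpowers σ) {d : TwistedPoly σ}
    (hfix : ∀ i, σ (d.coeff i) = d.coeff i)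
    (hdvd : ∀ i, d.coeff i ≠ 0 → Module.finrank F K ∣ i) : ∃ p : Polynomial F, central σ p = d := by
  choose c hc using fun i => exists_algebraMap_eq hσ (hfix i)
  have hn : 0 < Module.finrank F K := Module.finrank_pos
  refine ⟨∑ j ∈ Finset.range (d.natDegree + 1),
    Polynomial.monomial j (c (Module.finrank F K * j)), ext fun k => ?_⟩
  rw [coeff_central]
  split_ifs with h
  · obtain ⟨j, rfl⟩ := h
    rw [Nat.mul_div_cancel_left _ hn, Polynomial.finsetSum_coeff]
    simp only [Polynomial.coeff_monomial, Finset.sum_ite_eq', Finset.mem_range]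
    split_ifs with h
    · exact hc _
    · rw [map_zero, coeff_eq_zero_of_natDegree_lt]
      nlinarith
  · by_contra h0
    exact h (hdvd k (Ne.symm h0))

/-- If a nonzero `c` annihilates `R/Rf` and `f` has nonzero constant coefficient, then some
central polynomial of degree at most `deg c` lies in `Rf`. -/
lemma exists_central_mem_of_annihilates (hσ : ∀ ρ : K ≃ₐ[F] K, ρ ∈ Subgroup.zpowers σ)
    {f c : TwistedPoly σ} (hf : f.coeff 0 ≠ 0) (hc : c ≠ 0)
    (hann : ∀ v, c * v ∈ Ideal.span {f}) :
    ∃ p : Polynomial F, p.Monic ∧ central σ p ∈ Ideal.span {f} ∧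
      Module.finrank F K * p.natDegree ≤ c.natDegree := by
  classical
  have hf0 : f ≠ 0 := by
    rintro rfl
    exact hf (coeff_zero 0)
  have hex : ∃ N, ∃ d : TwistedPoly σ, d ≠ 0 ∧ (∀ v, d * v ∈ Ideal.span {f}) ∧ d.natDegree = N :=
    ⟨_, c, hc, hann, rfl⟩
  obtain ⟨d₀, hd₀, hann₀, hdeg₀⟩ := Nat.find_spec hex
  have hNc : Nat.find hex ≤ c.natDegree := Nat.find_min' hex ⟨c, hc, hann, rfl⟩
  -- The form in which minimality is used: each commutator-like expression below annihilates `R/Rf`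
  -- and has no coefficient from degree `N` on, hence vanishes.
  have hmin : ∀ e : TwistedPoly σ, (∀ v, e * v ∈ Ideal.span {f}) →
      (∀ i, Nat.find hex ≤ i → e.coeff i = 0) → e = 0 := by
    intro e he hi
    by_contra h0
    exact Nat.find_min hex (natDegree_lt_of_mem_degreeLT hi h0) ⟨e, h0, he, rfl⟩
  generalize Nat.find hex = N at *
  have hlc₀ : d₀.coeff N ≠ 0 := hdeg₀ ▸ coeff_natDegree_ne_zero hd₀
  obtain ⟨d, hd⟩ : ∃ d, d = (d₀.coeff N)⁻¹ • d₀ := ⟨_, rfl⟩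
  have hdN : d.coeff N = 1 := by rw [hd, coeff_smul, inv_mul_cancel₀ hlc₀]
  have hdgt : ∀ i, N < i → d.coeff i = 0 := fun i hi => by
    rw [hd, coeff_smul, coeff_eq_zero_of_natDegree_lt (f := d₀) (i := i) (by omega), mul_zero]
  have hdann : ∀ v, d * v ∈ Ideal.span {f} := fun v => by
    rw [hd, smul_mul]
    exact smul_mem_left _ (hann₀ v)
  -- If `d = et`, then `e` also annihilates, because `t` acts surjectively on `R/Rf`; but `e` has
  -- smaller degree.
  have hd0 : d.coeff 0 ≠ 0 := by
    intro h
    obtain ⟨e, he⟩ := exists_eq_mul_monomial_one h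
    have hshift : ∀ i, e.coeff i = d.coeff (i + 1) := fun i => by
      rw [he, coeff_mul_monomial]
      simp
    have hz : e = 0 := hmin e (fun v => by
      obtain ⟨w, hw⟩ := Petit.exists_sub_mul_mem hf0 (mem_span_of_monomial_one_mul_mem hf) v
      have : e * v = e * (v - monomial σ 1 1 * w) + d * w := by
        rw [he, mul_sub, mul_assoc]
        abel
      rw [this]
      exact Ideal.add_mem _ (Ideal.mul_mem_left _ _ hw) (hdann w))
      fun i hi => by rw [hshift, hdgt _ (by omega)]
    rw [hz, zero_mul] at he
    rw [he, coeff_zero] at hdN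
    exact zero_ne_one hdN
  -- The top terms cancel in `da - σ^N(a)d`, so it is zero; compare coefficients at `tⁱ`.
  have htwist : ∀ i a, d.coeff i ≠ 0 → (σ ^ i) a = (σ ^ N) a := by
    intro i a hi
    have hz : d * monomial σ 0 a - (σ ^ N) a • d = 0 := hmin _ (fun v => by
      rw [sub_mul, mul_assoc, smul_mul]
      exact Ideal.sub_mem _ (hdann _) (smul_mem_left _ (hdann v))) fun i hi => by
        rw [coeff_sub, coeff_mul_monomial, coeff_smul, if_pos (Nat.zero_le _), Nat.sub_zero]
        rcases hi.eq_or_lt with rfl | hi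
        · ring
        · rw [hdgt i hi]
          ring
    have := congrArg (fun e => coeff e i) hz
    simp only [coeff_sub, coeff_mul_monomial, coeff_smul, if_pos (Nat.zero_le _), Nat.sub_zero,
      coeff_zero] at this
    exact mul_left_cancel₀ hi ((sub_eq_zero.1 this).trans (mul_comm _ _))
  -- The commutator of `t` and `d` has degree at most `N`, since `d` is monic and its terms in
  -- degree `N + 1` cancel. Subtracting `s_N d` removes the term in degree `N`.
  obtain ⟨s, hs⟩ : ∃ s, s = monomial σ 1 1 * d - d * monomial σ 1 1 := ⟨_, rfl⟩
  have hs0 : s.coeff 0 = 0 := by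
    rw [hs, coeff_sub, coeff_monomial_mul, coeff_mul_monomial]
    simp
  have hs1 : ∀ i, s.coeff (i + 1) = σ (d.coeff i) - d.coeff i := fun i => by
    rw [hs, coeff_sub, coeff_monomial_mul, coeff_mul_monomial]
    simp
  have hsz : s - s.coeff N • d = 0 := hmin _ (fun v => by
    rw [hs, sub_mul, sub_mul, smul_mul, mul_assoc, mul_assoc]
    exact Ideal.sub_mem _ (Ideal.sub_mem _ (Ideal.mul_mem_left _ _ (hdann v)) (hdann _))
      (smul_mem_left _ (hdann v))) fun i hi => by
      rw [coeff_sub, coeff_smul]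
      rcases hi.eq_or_lt with rfl | hi
      · rw [hdN, mul_one, sub_self]
      · obtain ⟨j, rfl⟩ : ∃ j, i = j + 1 := ⟨i - 1, by omega⟩
        rw [hdgt _ hi, mul_zero, sub_zero, hs1]
        rcases (Nat.lt_succ_iff.1 hi).eq_or_lt with rfl | hj
        · rw [hdN, map_one, sub_self]
        · rw [hdgt j hj, map_zero, sub_self]
  -- The commutator has no constant term while `d` has one, so `s = s_N d` forces `s_N = 0`. Hence
  -- `s = 0`, that is, `σ` fixes all coefficients of `d`.
  have hsN : s.coeff N = 0 := by
    have := congrArg (fun e => coeff e 0) hsz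
    simp only [coeff_sub, coeff_smul, hs0, coeff_zero, zero_sub, neg_eq_zero] at this
    exact (mul_eq_zero.1 this).resolve_right hd0
  have hfix : ∀ i, σ (d.coeff i) = d.coeff i := fun i => by
    rw [hsN, zero_smul, sub_zero] at hsz
    have := hs1 i
    rw [hsz, coeff_zero] at this
    exact (sub_eq_zero.1 this.symm)
  have hdvd : ∀ i, d.coeff i ≠ 0 → Module.finrank F K ∣ i := by
    intro i hi
    have : σ ^ i = 1 := by
      ext a
      -- Comparing with the exponent `0`, where `d` has a nonzero coefficient, gives `σ^i = σ^N =
      -- σ^0`.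
      rw [htwist i a hi, ← htwist 0 a hd0, pow_zero]
    rw [← orderOf_eq_finrank hσ]
    exact orderOf_dvd_of_pow_eq_one this
  obtain ⟨p, hp⟩ := exists_central_eq hσ hfix hdvd
  obtain ⟨j, rfl⟩ := hdvd N (by rw [hdN]; exact one_ne_zero)
  have hle : p.natDegree ≤ j := by
    rw [Polynomial.natDegree_le_iff_coeff_eq_zero]
    intro i hi
    apply (algebraMap F K).injective
    rw [← coeff_central_mul (σ := σ), hp, map_zero]
    exact hdgt _ (Nat.mul_lt_mul_of_pos_left hi Module.finrank_pos)
  refine ⟨p, Polynomial.monic_of_natDegree_le_of_coeff_eq_one j hle ?_, ?_, ?_⟩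
  · apply (algebraMap F K).injective
    rw [← coeff_central_mul (σ := σ), hp, map_one, hdN]
  · rw [hp, ← mul_one d]
    exact hdann 1
  · exact (Nat.mul_le_mul_left _ hle).trans hNc

/-! ### Polynomials with the same minimal central left multiple -/

/-- Irreducible polynomials with the same minimal central left multiple are similar. -/
theorem exists_mul_mem_span_of_isMclm (hσ : ∀ ρ : K ≃ₐ[F] K, ρ ∈ Subgroup.zpowers σ)
    {f g : TwistedPoly σ} {h : Polynomial F} (hf : Irreducible f) (hg : Irreducible g)
    (hfh : f.IsMclm h) (hgh : g.IsMclm h) : ∃ u ∉ Ideal.span {f}, g * u ∈ Ideal.span {f} := by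
  by_cases h0 : f.coeff 0 = 0
  -- Both polynomials are scalar multiples of `t`, so `u = 1` works.
  · refine ⟨1, fun h1 => ?_, ?_⟩
    · obtain ⟨q, hq⟩ := mem_span_iff.1 h1
      exact hf.not_isUnit (IsUnit.of_mul_eq_one_right q hq.symm)
    · obtain ⟨b, hb, rfl⟩ :=
        exists_eq_smul_monomial_one hg (coeff_zero_eq_zero_of_isMclm hf hg hfh hgh h0)
      obtain ⟨a, ha, rfl⟩ := exists_eq_smul_monomial_one hf h0
      have : b • monomial σ 1 1 * 1 = (b * a⁻¹) • a • monomial σ 1 1 := by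
        rw [mul_one, smul_smul, mul_assoc, inv_mul_cancel₀ ha, mul_one]
      rw [this]
      exact smul_mem_left _ (Ideal.mem_span_singleton_self _)
  · by_contra! hcon
    have hinj : ∀ v, g * v ∈ Ideal.span {f} → v ∈ Ideal.span {f} := fun v hv =>
      by_contra fun hv' => hcon v hv' hv
    obtain ⟨⟨hm, c, hc⟩, -⟩ := hgh
    have hcg : c ≠ 0 := by
      rintro rfl
      rw [zero_mul] at hc
      exact central_ne_zero hm.ne_zero hc
    -- Centrality of `cg` gives `(cg)g = g(cg)`; cancel `g` on the right.
    have hcomm : g * c = c * g := by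
      have := central_mul_comm hσ h g
      rw [hc, ← mul_assoc] at this
      exact (mul_right_cancel₀ hg.ne_zero this).symm
    obtain ⟨q, hq⟩ := hfh.1.2
    -- `g(cv) = h(tⁿ)v = v h(tⁿ)` lies in `Rf`, and `g` acts injectively.
    have hann : ∀ v, c * v ∈ Ideal.span {f} := fun v => by
      refine hinj _ ?_
      rw [← mul_assoc, hcomm, ← hc, central_mul_comm hσ, hq]
      exact Ideal.mul_mem_left _ _ (mem_span_iff.2 ⟨q, rfl⟩)
    obtain ⟨p, hpm, hp, hpd⟩ := exists_central_mem_of_annihilates hσ h0 hcg hann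
    have h1 := hfh.2 p hpm (mem_span_iff.1 hp)
    have h2 := natDegree_central_le (σ := σ) h
    -- `deg c = deg h(tⁿ) - deg g < n deg h`, whereas minimality of `h` gives `n deg h ≤ n deg p ≤
    -- deg c`.
    rw [hc, natDegree_mul hcg hg.ne_zero] at h2
    have h3 := natDegree_pos_of_irreducible hg
    have h4 := Nat.mul_le_mul_left (Module.finrank F K) h1
    omega

end Central

end TwistedPoly

/-! ### Isotopies between Petit algebras -/

namespace Petit

open TwistedPoly

variable {F K : Type*} [Field F] [Field K] [Algebra F K] {σ : K ≃ₐ[F] K}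

lemma isotopicOver_of_addEquiv {f g : TwistedPoly σ} (E : Subfield F)
    (φ ψ χ : Petit f ≃+ Petit g) (hφ : ∀ (c : E) (x : Petit f), φ (c • x) = c • φ x)
    (hψ : ∀ (c : E) (x : Petit f), ψ (c • x) = c • ψ x)
    (hχ : ∀ (c : E) (x : Petit f), χ (c • x) = c • χ x)
    (h : ∀ x y, χ (x * y) = φ x * ψ y) : IsotopicOver E (Petit f) (Petit g) :=
  ⟨φ.toLinearEquiv hφ, ψ.toLinearEquiv hψ, χ.toLinearEquiv hχ, h⟩

/-- Similar irreducible polynomials of the same degree have isotopic Petit algebras. -/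
theorem isotopicOver_of_mul_mem_span {f g u : TwistedPoly σ} (E : Subfield F)
    (hf : Irreducible f) (hg : g ≠ 0) (hdeg : g.natDegree = f.natDegree)
    (hu : u ∉ Ideal.span {f}) (hgu : g * u ∈ Ideal.span {f}) :
    IsotopicOver E (Petit g) (Petit f) := by
  have hsurj := rightMulMod_surjective hf hu hg hgu
  have hinj := (LinearMap.injective_iff_surjective_of_finrank_eq_finrank
    (by rw [finrank_degreeLT, finrank_degreeLT, hdeg])).2 hsurj
  -- The left factor keeps its coefficients, while the right factor and the product are multiplied
  -- by `u` modulo `f`.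
  let φ : Petit g ≃ₗ[K] Petit f :=
    LinearEquiv.ofEq (degreeLT σ g.natDegree) (degreeLT σ f.natDegree) (by rw [hdeg])
  let χ : Petit g ≃ₗ[K] Petit f :=
    LinearEquiv.ofBijective (rightMulMod g.natDegree u f) ⟨hinj, hsurj⟩
  refine isotopicOver_of_addEquiv E φ.toAddEquiv χ.toAddEquiv χ.toAddEquiv
    (fun c x => φ.map_smul (algebraMap F K c) x) (fun c x => χ.map_smul (algebraMap F K c) x)
    (fun c x => χ.map_smul (algebraMap F K c) x) fun x y => ?_
  have hχ : ∀ z : Petit g, χ z = modRight (z.toPoly * u) f := fun _ => rfl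
  have hφ : (φ x).toPoly = x.toPoly := rfl
  change χ (x * y) = φ x * χ y
  rw [mul_def (φ x), hφ, hχ]
  refine (modRight_eq_modRight_iff hf.ne_zero).2 ?_
  have h1 : x.toPoly * y.toPoly - (x * y).toPoly ∈ Ideal.span {g} :=
    sub_modRight_mem (x.toPoly * y.toPoly) hg
  have h2 : y.toPoly * u - (χ y).toPoly ∈ Ideal.span {f} :=
    sub_modRight_mem (y.toPoly * u) hf.ne_zero
  obtain ⟨q, hq⟩ := mem_span_iff.1 h1
  -- Reducing `xy` modulo `g` costs a multiple `q(gu)`, which lies in `Rf`; this is where `gu ∈ Rf`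
  -- enters.
  have h3 : (x * y).toPoly * u - x.toPoly * (χ y).toPoly =
      x.toPoly * (y.toPoly * u - (χ y).toPoly) - q * (g * u) := by
    rw [← mul_assoc q, ← hq]
    noncomm_ring
  rw [h3]
  exact Ideal.sub_mem _ (Ideal.mul_mem_left _ _ h2) (Ideal.mul_mem_left _ _ hgu)

end Petit

namespace TwistedPoly

variable {F K : Type*} [Field F] [Field K] [Algebra F K] {σ : K ≃ₐ[F] K}

/-! ### The automorphism `∑ aᵢ tⁱ ↦ ∑ τ(aᵢ) (αt)ⁱ` -/

/-- The cocycle rule behind `(αt)^{i+j} = (αt)^i (αt)^j`, since `(αt)^i = N_i^σ(α) tⁱ`. -/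
lemma twistedNorm_add (i j : ℕ) (a : K) :
    twistedNorm σ (i + j) a = twistedNorm σ i a * (σ ^ i) (twistedNorm σ j a) := by
  rw [twistedNorm, Finset.prod_range_add, twistedNorm, twistedNorm, map_prod]
  congr 1
  refine Finset.prod_congr rfl fun k _ => ?_
  rw [pow_add]
  rfl

lemma twistedNorm_ne_zero (i : ℕ) (α : Kˣ) : twistedNorm σ i (α : K) ≠ 0 :=
  Finset.prod_ne_zero_iff.2 fun _ _ => (map_ne_zero _).2 α.ne_zero

/-- The powers `σ^0, …, σ^{n-1}` run once through the Galois group, so one block of `n` factors is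
the norm; later blocks repeat it because `σⁿ = 1`. -/
lemma twistedNorm_finrank_mul [FiniteDimensional F K] [IsGalois F K]
    (hσ : ∀ ρ : K ≃ₐ[F] K, ρ ∈ Subgroup.zpowers σ) (i : ℕ) (a : K) :
    twistedNorm σ (Module.finrank F K * i) a = algebraMap F K (Algebra.norm F a ^ i) := by
  have h1 : twistedNorm σ (Module.finrank F K) a = algebraMap F K (Algebra.norm F a) := by
    classical
    rw [Algebra.norm_eq_prod_automorphisms, twistedNorm, ← orderOf_eq_finrank hσ,
      ← IsCyclic.image_range_orderOf hσ, Finset.prod_image]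
    intro x hx y hy h
    exact pow_injOn_Iio_orderOf (by simpa using hx) (by simpa using hy) h
  induction i with
  | zero => simp [twistedNorm]
  | succ i ih =>
    rw [mul_add, mul_one, twistedNorm_add, ih, pow_finrank_mul hσ, h1, pow_succ, map_mul]
    rfl

lemma autStable_pow_comm (τ : autStable σ) (i : ℕ) (a : K) :
    (τ : RingAut K) ((σ ^ i) a) = (σ ^ i) ((τ : RingAut K) a) := by
  induction i with
  | zero => rfl
  | succ i ih =>
    rw [pow_succ', AlgEquiv.mul_apply, AlgEquiv.mul_apply, τ.2.1, ih]

/-- The map `∑ aᵢ tⁱ ↦ ∑ τ(aᵢ) (αt)ⁱ`. -/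
noncomputable def substFun (α : Kˣ) (τ : RingAut K) (f : TwistedPoly σ) : TwistedPoly σ :=
  ∑ i ∈ f.support, monomial σ i (τ (f.coeff i) * twistedNorm σ i (α : K))

lemma coeff_substFun (α : Kˣ) (τ : RingAut K) (f : TwistedPoly σ) (i : ℕ) :
    (substFun α τ f).coeff i = τ (f.coeff i) * twistedNorm σ i (α : K) := by
  rw [substFun, coeff_sum]
  simp only [coeff_monomial, Finset.sum_ite_eq']
  split_ifs with h
  · rfl
  · rw [mem_support, not_not] at h
    rw [h, map_zero, zero_mul]

/-- The ring automorphism `∑ aᵢ tⁱ ↦ ∑ τ(aᵢ) (αt)ⁱ` of `K[t; σ]`, for `τ` commuting with `σ`. -/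
noncomputable def substEquiv (α : Kˣ) (τ : autStable σ) : TwistedPoly σ ≃+* TwistedPoly σ :=
  RingEquiv.ofBijective
    ({ toFun := substFun α τ
       map_one' := ext fun i => by
        rw [coeff_substFun, coeff_one]
        split_ifs with h
        · simp [h, twistedNorm]
        · simp
       map_zero' := ext fun i => by simp [coeff_substFun, coeff_zero]
       map_add' := fun f g => ext fun i => by
        simp only [coeff_substFun, coeff_add, map_add, add_mul]
       map_mul' := fun f g => ext fun i => by
        rw [coeff_substFun, coeff_mul, coeff_mul, map_sum, Finset.sum_mul]
        refine Finset.sum_congr rfl fun p hp => ?_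
        rw [← Finset.HasAntidiagonal.mem_antidiagonal.1 hp, coeff_substFun, coeff_substFun,
          twistedNorm_add, map_mul, map_mul, autStable_pow_comm]
        ring } : TwistedPoly σ →+* TwistedPoly σ)
    ⟨fun f g h => ext fun i => by
      have := congrArg (fun f => coeff f i) h
      change (substFun α τ f).coeff i = (substFun α τ g).coeff i at this
      rw [coeff_substFun, coeff_substFun] at this
      exact (τ : RingAut K).injective (mul_right_cancel₀ (twistedNorm_ne_zero i α) this),
    fun g => by
      obtain ⟨f, hf⟩ := exists_coeff_eq (σ := σ) (g.natDegree + 1)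
        (fun i => (τ : RingAut K).symm (g.coeff i / twistedNorm σ i (α : K)))
        fun i hi => by
          rw [coeff_eq_zero_of_natDegree_lt (by omega), zero_div, map_zero]
      refine ⟨f, ext fun i => ?_⟩
      change (substFun α τ f).coeff i = _
      rw [coeff_substFun, hf, RingEquiv.apply_symm_apply,
        div_mul_cancel₀ _ (twistedNorm_ne_zero i α)]⟩

lemma coeff_substEquiv (α : Kˣ) (τ : autStable σ) (f : TwistedPoly σ) (i : ℕ) :
    (substEquiv α τ f).coeff i = (τ : RingAut K) (f.coeff i) * twistedNorm σ i (α : K) :=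
  coeff_substFun α τ f i

lemma substEquiv_smul (α : Kˣ) (τ : autStable σ) (a : K) (f : TwistedPoly σ) :
    substEquiv α τ (a • f) = (τ : RingAut K) a • substEquiv α τ f :=
  ext fun i => by rw [coeff_smul, coeff_substEquiv, coeff_substEquiv, coeff_smul, map_mul, mul_assoc]

lemma coeff_substEquiv_eq_zero_iff (α : Kˣ) (τ : autStable σ) (f : TwistedPoly σ) (i : ℕ) :
    (substEquiv α τ f).coeff i = 0 ↔ f.coeff i = 0 := by
  rw [coeff_substEquiv, mul_eq_zero, or_iff_left (twistedNorm_ne_zero i α), map_eq_zero_iff _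
    (τ : RingAut K).injective]

lemma natDegree_substEquiv (α : Kˣ) (τ : autStable σ) (f : TwistedPoly σ) :
    (substEquiv α τ f).natDegree = f.natDegree := by
  have h : (substEquiv α τ f).support = f.support := by
    ext i
    simp [mem_support, coeff_substEquiv_eq_zero_iff]
  rw [natDegree, natDegree, h]

lemma twist_eq (f : TwistedPoly σ) (α : Kˣ) (τ : autStable σ) :
    f.twist α τ = twistedNorm σ f.natDegree ((α⁻¹ : Kˣ) : K) • substEquiv α τ f := rfl

lemma natDegree_twist (f : TwistedPoly σ) (α : Kˣ) (τ : autStable σ) :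
    (f.twist α τ).natDegree = f.natDegree := by
  rw [twist_eq, natDegree_smul (twistedNorm_ne_zero _ _), natDegree_substEquiv]

lemma irreducible_twist {f : TwistedPoly σ} (hf : Irreducible f) (α : Kˣ) (τ : autStable σ) :
    Irreducible (f.twist α τ) := by
  rw [twist_eq, smul_eq_monomial_mul,
    irreducible_isUnit_mul (isUnit_monomial_zero (twistedNorm_ne_zero _ _))]
  exact (MulEquiv.irreducible_iff (substEquiv α τ)).2 hf

/-- The twist of `f` is a unit times the image of `f` under a ring automorphism, so the automorphism
carries `Rf` onto the left ideal of the twist. -/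
lemma substEquiv_mem_span_twist_iff {f g : TwistedPoly σ} (α : Kˣ) (τ : autStable σ) :
    substEquiv α τ g ∈ Ideal.span {f.twist α τ} ↔ g ∈ Ideal.span {f} := by
  rw [mem_span_iff, mem_span_iff, twist_eq, smul_eq_monomial_mul]
  obtain ⟨v, hv⟩ := isUnit_monomial_zero (σ := σ)
    (twistedNorm_ne_zero (σ := σ) f.natDegree α⁻¹)
  rw [← hv]
  constructor
  · rintro ⟨q, hq⟩
    refine ⟨(substEquiv α τ).symm (q * v), (substEquiv α τ).injective ?_⟩
    rw [hq, map_mul, RingEquiv.apply_symm_apply, mul_assoc]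
  · rintro ⟨q, rfl⟩
    exact ⟨substEquiv α τ q * ((v⁻¹ : (TwistedPoly σ)ˣ) : TwistedPoly σ),
      by rw [map_mul, mul_assoc, Units.inv_mul_cancel_left]⟩

/-! ### The minimal central left multiple of a twist -/

section Mclm

variable [FiniteDimensional F K] [IsGalois F K]

/-- The twisted norm in degree `nj` is `u^j`, the factor produced by substituting `ux` for `x`. The
scalar `u^d` undoes the normalisation in `polyTwist`; `d` is arbitrary, so polynomials of any degree
can be compared. -/
lemma substEquiv_central (hσ : ∀ ρ : K ≃ₐ[F] K, ρ ∈ Subgroup.zpowers σ) {α : Kˣ}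
    (τ : autStable σ) {u : Fˣ} (hu : Algebra.norm F (α : K) = u) (d : ℕ) (p : Polynomial F) :
    substEquiv α τ (central σ p) =
      algebraMap F K ((u : F) ^ d) • central σ (polyTwist d u (restrictBase σ τ) p) := by
  refine ext fun i => ?_
  rw [coeff_substEquiv, coeff_smul, coeff_central, coeff_central]
  split_ifs with h
  · obtain ⟨j, rfl⟩ := h
    rw [Nat.mul_div_cancel_left _ Module.finrank_pos, twistedNorm_finrank_mul hσ, hu,
      ← algebraMap_restrictBase, coeff_polyTwist, ← map_mul, ← map_mul, ← mul_assoc, ← mul_pow,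
      Units.mul_inv, one_pow, one_mul]
  · simp

lemma central_polyTwist_mem_iff (hσ : ∀ ρ : K ≃ₐ[F] K, ρ ∈ Subgroup.zpowers σ)
    {f : TwistedPoly σ} {α : Kˣ} (τ : autStable σ) {u : Fˣ}
    (hu : Algebra.norm F (α : K) = u) (d : ℕ) (p : Polynomial F) :
    central σ (polyTwist d u (restrictBase σ τ) p) ∈ Ideal.span {f.twist α τ} ↔
      central σ p ∈ Ideal.span {f} := by
  rw [← substEquiv_mem_span_twist_iff (f := f) (g := central σ p) α τ,
    substEquiv_central hσ τ hu d]
  refine ⟨smul_mem_left _, fun h => ?_⟩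
  have h0 : algebraMap F K ((u : F) ^ d) ≠ 0 := (map_ne_zero _).2 (pow_ne_zero _ u.ne_zero)
  have := smul_mem_left (algebraMap F K ((u : F) ^ d))⁻¹ h
  rwa [smul_smul, inv_mul_cancel₀ h0, one_smul] at this

lemma exists_monic_polyTwist_eq {h : Polynomial F} (hm : h.Monic) (u : Fˣ) (ρ : RingAut F) :
    ∃ p : Polynomial F, p.Monic ∧ p.natDegree = h.natDegree ∧
      polyTwist h.natDegree u ρ p = h := by
  have hmul : ∀ c, ρ (ρ⁻¹ c) = c := fun c => ρ.apply_symm_apply c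
  -- The pair `(ρ⁻¹(u⁻¹), ρ⁻¹)` is the inverse of `(u, ρ)` in the semidirect product.
  refine ⟨polyTwist h.natDegree (Units.mapEquiv (ρ⁻¹ : RingAut F).toMulEquiv u⁻¹) ρ⁻¹ h,
    ?_, natDegree_polyTwist _ _ _ _, ?_⟩
  · rw [Polynomial.Monic, Polynomial.leadingCoeff, natDegree_polyTwist, coeff_polyTwist,
      hm.coeff_natDegree, map_one, one_mul, ← mul_pow, Units.inv_mul, one_pow]
  · ext i
    rw [coeff_polyTwist, coeff_polyTwist, map_mul, map_mul, map_pow, map_pow, hmul, ← map_inv,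
      inv_inv]
    simp only [Units.coe_mapEquiv, RingEquiv.toMulEquiv_eq_coe, RingEquiv.coe_toMulEquiv, hmul]
    have h0 : (u : F) ≠ 0 := u.ne_zero
    simp only [Units.val_inv_eq_inv_val, inv_pow]
    field_simp

theorem isMclm_twist (hσ : ∀ ρ : K ≃ₐ[F] K, ρ ∈ Subgroup.zpowers σ) {f : TwistedPoly σ}
    {h : Polynomial F} (hfh : f.IsMclm h) {α : Kˣ} (τ : autStable σ) {u : Fˣ}
    (hu : Algebra.norm F (α : K) = u) :
    (f.twist α τ).IsMclm (polyTwist h.natDegree u (restrictBase σ τ) h) := by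
  refine ⟨⟨?_, ?_⟩, fun h' hm hh' => ?_⟩
  · rw [Polynomial.Monic, Polynomial.leadingCoeff, natDegree_polyTwist, coeff_polyTwist,
      hfh.1.1.coeff_natDegree, map_one, one_mul, ← mul_pow, Units.inv_mul, one_pow]
  · exact mem_span_iff.1
      ((central_polyTwist_mem_iff hσ τ hu _ h).2 (mem_span_iff.2 hfh.1.2))
  · obtain ⟨p, hpm, hpd, hp⟩ := exists_monic_polyTwist_eq hm u (restrictBase σ τ)
    rw [natDegree_polyTwist, ← hpd]
    refine hfh.2 p hpm (mem_span_iff.1 ?_)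
    rw [← central_polyTwist_mem_iff hσ τ hu h'.natDegree, hp]
    exact mem_span_iff.2 hh'

end Mclm

end TwistedPoly

/-! ### Isotopies from twists -/

lemma IsotopicOver.trans {E A B C : Type*} [Field E] [NonUnitalNonAssocRing A]
    [NonUnitalNonAssocRing B] [NonUnitalNonAssocRing C] [Module E A] [Module E B] [Module E C]
    (hAB : IsotopicOver E A B) (hBC : IsotopicOver E B C) : IsotopicOver E A C := by
  obtain ⟨φ, ψ, χ, h⟩ := hAB
  obtain ⟨φ', ψ', χ', h'⟩ := hBC
  exact ⟨φ.trans φ', ψ.trans ψ', χ.trans χ', fun x y => by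
    simp only [LinearEquiv.trans_apply, h, h']⟩

namespace Petit

open TwistedPoly

variable {F K : Type*} [Field F] [Field K] [Algebra F K] {σ : K ≃ₐ[F] K}

/-- The additive map `R/Rf → R/Rf^{(α,τ)}` induced by `∑ aᵢ tⁱ ↦ ∑ τ(aᵢ) (αt)ⁱ`. -/
noncomputable def twistHom (f : TwistedPoly σ) (α : Kˣ) (τ : autStable σ) :
    Petit f →+ Petit (f.twist α τ) :=
  AddMonoidHom.mk' (fun x => ⟨substEquiv α τ x.toPoly, fun i hi => by
      rw [coeff_substEquiv_eq_zero_iff]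
      exact x.toPoly_mem i ((natDegree_twist f α τ).symm.trans_le hi)⟩)
    fun x y => toPoly_injective (map_add (substEquiv α τ) x.toPoly y.toPoly)

lemma toPoly_twistHom (f : TwistedPoly σ) (α : Kˣ) (τ : autStable σ) (x : Petit f) :
    (twistHom f α τ x).toPoly = substEquiv α τ x.toPoly := rfl

lemma twistHom_bijective (f : TwistedPoly σ) (α : Kˣ) (τ : autStable σ) :
    Function.Bijective (twistHom f α τ) := by
  constructor
  · intro x y h
    have h1 := congrArg toPoly h
    rw [toPoly_twistHom, toPoly_twistHom] at h1
    exact toPoly_injective ((substEquiv α τ).injective h1)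
  · intro y
    obtain ⟨p, hp⟩ := (substEquiv α τ).surjective y.toPoly
    have hmem : p ∈ degreeLT σ f.natDegree := fun i hi => by
      rw [← coeff_substEquiv_eq_zero_iff α τ, hp]
      exact y.toPoly_mem i ((natDegree_twist f α τ).trans_le hi)
    let x : Petit f := ⟨p, hmem⟩
    refine ⟨x, toPoly_injective ?_⟩
    rw [toPoly_twistHom, ← hp]
    rfl

/-- The additive bijection `R/Rf → R/Rf^{(α,τ)}` induced by `∑ aᵢ tⁱ ↦ ∑ τ(aᵢ) (αt)ⁱ`. -/
noncomputable def twistEquiv (f : TwistedPoly σ) (α : Kˣ) (τ : autStable σ) :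
    Petit f ≃+ Petit (f.twist α τ) :=
  AddEquiv.ofBijective (twistHom f α τ) (twistHom_bijective f α τ)

lemma twistEquiv_mul {f : TwistedPoly σ} (hf : Irreducible f) (α : Kˣ) (τ : autStable σ)
    (x y : Petit f) : twistEquiv f α τ (x * y) = twistEquiv f α τ x * twistEquiv f α τ y := by
  rw [mul_def (twistEquiv f α τ x)]
  refine (modRight_eq_of_sub_mem (irreducible_twist hf α τ).ne_zero ?_).symm
  have h : x.toPoly * y.toPoly - (x * y).toPoly ∈ Ideal.span {f} :=
    sub_modRight_mem (x.toPoly * y.toPoly) hf.ne_zero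
  rw [← substEquiv_mem_span_twist_iff α τ, map_sub, map_mul] at h
  exact h

/-- The induced ring isomorphism serves as all three maps. It is `τ`-semilinear, hence linear over a
subfield fixed by `τ`. -/
theorem isotopicOver_twist {f : TwistedPoly σ} (hf : Irreducible f) (α : Kˣ) (τ : autStable σ)
    (E : Subfield F) (hE : ∀ c ∈ E, restrictBase σ τ c = c) :
    IsotopicOver E (Petit f) (Petit (f.twist α τ)) := by
  have h : ∀ (c : E) (x : Petit f), twistEquiv f α τ (c • x) = c • twistEquiv f α τ x := by
    intro c x
    apply toPoly_injective
    change substEquiv α τ (algebraMap F K c • x.toPoly) = algebraMap F K c • substEquiv α τ x.toPoly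
    rw [substEquiv_smul, ← algebraMap_restrictBase, hE c c.2]
  exact isotopicOver_of_addEquiv E _ _ _ h h h (twistEquiv_mul hf α τ)

end Petit

/-! ### The main theorem -/

theorem theorem3 {F K : Type*} [Field F] [Field K] [Algebra F K] [FiniteDimensional F K]
    [IsGalois F K] (σ : K ≃ₐ[F] K) (hσ : ∀ ρ : K ≃ₐ[F] K, ρ ∈ Subgroup.zpowers σ)
    (m m₀ : ℕ) (f g : TwistedPoly σ) (hf : Irreducible f) (hg : Irreducible g)
    (hfm : f.natDegree = m) (hgm : g.natDegree = m) (h₁ h₂ : MonicIrred F m₀)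
    (hf₁ : f.IsMclm h₁.1) (hg₂ : g.IsMclm h₂.1)
    (horb : h₂ ∈ MulAction.orbit (OrbitGroup σ) h₁) :
    (IsNonassocDivisionRing (Petit f) ∧ IsNonassocDivisionRing (Petit g) ∧
      IsotopicRings F (Petit f) (Petit g)) ∧
    ∀ γ : OrbitGroup σ, γ • h₁ = h₂ →
      IsotopicOver (fixedBase γ.right) (Petit f) (Petit g) ∧
      ∀ τ : autStable σ, restrictBase σ τ = restrictBase σ γ.right →
        ∀ α : Kˣ, Algebra.norm F (α : K) = ((γ.left : Fˣ) : F) →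
          Irreducible (f.twist α τ) ∧ (f.twist α τ).natDegree = m ∧
          (f.twist α τ).IsMclm (γ • h₁).1 ∧
          IsNonassocDivisionRing (Petit (f.twist α τ)) ∧
          IsotopicOver (fixedBase γ.right) (Petit f) (Petit (f.twist α τ)) ∧
          IsotopicOver (fixedBase γ.right) (Petit (f.twist α τ)) (Petit g) := by
  have main : ∀ γ : OrbitGroup σ, γ • h₁ = h₂ → ∀ τ : autStable σ,
      restrictBase σ τ = restrictBase σ γ.right → ∀ α : Kˣ,
        Algebra.norm F (α : K) = ((γ.left : Fˣ) : F) →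
          (f.twist α τ).IsMclm (γ • h₁).1 ∧
          IsotopicOver (fixedBase γ.right) (Petit f) (Petit (f.twist α τ)) ∧
          IsotopicOver (fixedBase γ.right) (Petit (f.twist α τ)) (Petit g) := by
    intro γ hγ τ hτ α hα
    have hmclm : (f.twist α τ).IsMclm (γ • h₁).1 := by
      have h := TwistedPoly.isMclm_twist hσ hf₁ τ hα
      rwa [h₁.2.2.2, hτ, ← OrbitGroup.coe_smul] at h
    have hirr := TwistedPoly.irreducible_twist hf α τ
    -- The twist of `f` and `g` now share the minimal central left multiple given by `h₂`, so they
    -- are similar.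
    obtain ⟨u, hu, hfu⟩ :=
      TwistedPoly.exists_mul_mem_span_of_isMclm hσ hg hirr hg₂ (hγ ▸ hmclm)
    refine ⟨hmclm, Petit.isotopicOver_twist hf α τ _ fun c hc => ?_,
      Petit.isotopicOver_of_mul_mem_span _ hg hirr.ne_zero
        (by rw [TwistedPoly.natDegree_twist, hfm, hgm]) hu hfu⟩
    rw [hτ]
    exact hc
  have hiso : ∀ γ : OrbitGroup σ, γ • h₁ = h₂ →
      IsotopicOver (fixedBase γ.right) (Petit f) (Petit g) := by
    intro γ hγ
    -- `γ.left` is a norm by definition of `G`, so a suitable `α` exists, and the isotopy passes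
    -- through that twist.
    obtain ⟨α, hα⟩ := γ.left.2
    obtain ⟨-, h1, h2⟩ := main γ hγ γ.right rfl α (congrArg Units.val hα)
    exact h1.trans h2
  obtain ⟨γ₀, hγ₀⟩ := horb
  refine ⟨⟨Petit.isNonassocDivisionRing hf, Petit.isNonassocDivisionRing hg, _, hiso γ₀ hγ₀⟩,
    fun γ hγ => ⟨hiso γ hγ, fun τ hτ α hα => ?_⟩⟩
  obtain ⟨h1, h2, h3⟩ := main γ hγ τ hτ α hα
  have hirr := TwistedPoly.irreducible_twist hf α τ
  exact ⟨hirr, (TwistedPoly.natDegree_twist f α τ).trans hfm, h1,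
    Petit.isNonassocDivisionRing hirr, h2, h3⟩
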